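/- Let $n\ge 4$ be an even integer, let $u:\mathbb{R}^n\to\mathbb{R}$ be smooth, and let $g=e^{2u}|dx|^2$, with scalar curvature $R_g$ and Q-curvature $Q$ given by $(-\Delta)^{n/2}u=Qe^{nu}$. Suppose that $g$ has finite total Q-curvature, i.e. $Qe^{nu}\in L^1(\mathbb{R}^n)$, and that $g$ is normal, i.e. for some constant $C$ and all $x\in\mathbb{R}^n$ $$u(x)=\frac{2}{(n-1)!\,|\mathbb{S}^n|}\int_{\mathbb{R}^n}\log\frac{|y|}{|x-y|}\,Q(y)e^{nu(y)}\,dy+C.$$ Let the conformal mass of $g$ be $$m_c(g):=\frac{1}{(n-1)(n-2)|\mathbb{S}^{n-1}|}\,\inf_{x\in\mathbb{R}^n}\,\liminf_{r\to\infty}\, r^{3-n}\int_{\partial B_r(x)}R_g e^{2u}\,d\sigma\in[-\infty,+\infty],$$ where $d\sigma$ is the Euclidean area element and $|\mathbb{S}^k|$ is the area of the unit sphere $\mathbb{S}^k\subset\mathbb{R}^{k+1}$. Then $$m_c(g)=-\frac{4}{n!\,|\mathbb{S}^n|}\int_{\mathbb{R}^n}x\cdot\nabla Q\; e^{nu}\,dx$$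 whenever the integral on the right exists, either as a Lebesgue integral ($x\cdot\nabla Q\,e^{nu}\in L^1(\mathbb{R}^n)$) or as an improper integral $\lim_{r\to\infty}\int_{B_r(0)}x\cdot\nabla Q\,e^{nu}\,dx\in\mathbb{R}$. Without any assumption on the existence of this integral, $m_c(g)$ is finite and there is a sequence $r_k\to\infty$ with $$m_c(g)=-\frac{4}{n!\,|\mathbb{S}^n|}\lim_{k\to\infty}\int_{B_{r_k}(0)}x\cdot\nabla Q\;e^{nu}\,dx .$$ -/

import Mathlib

open MeasureTheory Filter Topology Metric
open scoped ContDiff Gradient Nat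

/-- `ℝⁿ` with its Euclidean norm. -/
abbrev RSpace (n : ℕ) : Type := EuclideanSpace ℝ (Fin n)

noncomputable section

/-! ### Spheres -/

/-- `|𝕊ᵏ|`, the area of the unit sphere of `ℝᵏ⁺¹`. -/
def sphereArea (k : ℕ) : ℝ :=
  ((volume : Measure (RSpace (k + 1))).toSphere).real Set.univ

/-- `∫_{∂B_r(x)} f dσ`, where `dσ` is the Euclidean area element of the sphere `∂B_r(x)`, `r > 0`. -/
def sphereIntegral {n : ℕ} (f : RSpace n → ℝ) (x : RSpace n) (r : ℝ) : ℝ :=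
  r ^ (n - 1) *
    ∫ w : sphere (0 : RSpace n) 1, f (x + r • (w : RSpace n)) ∂(volume : Measure (RSpace n)).toSphere

/-! ### Curvature of a Riemannian metric on `ℝⁿ`, in the standard coordinates -/

/-- The partial derivative `∂ᵢ f`. -/
def partialDeriv {n : ℕ} (i : Fin n) (f : RSpace n → ℝ) (x : RSpace n) : ℝ :=
  fderiv ℝ f x (EuclideanSpace.single i 1)

/-- Christoffel symbols `Γᵏᵢⱼ = ½ ∑ₗ gᵏˡ (∂ᵢ gⱼₗ + ∂ⱼ gᵢₗ - ∂ₗ gᵢⱼ)`. -/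
def christoffel {n : ℕ} (g : RSpace n → Matrix (Fin n) (Fin n) ℝ) (k i j : Fin n)
    (x : RSpace n) : ℝ :=
  (1 / 2) * ∑ l, (g x)⁻¹ k l *
    (partialDeriv i (fun y => g y j l) x + partialDeriv j (fun y => g y i l) x
      - partialDeriv l (fun y => g y i j) x)

/-- Ricci curvature
`Rᵢⱼ = ∑ₖ (∂ₖ Γᵏᵢⱼ - ∂ⱼ Γᵏᵢₖ) + ∑ₖₗ (Γᵏₖₗ Γˡᵢⱼ - Γᵏⱼₗ Γˡᵢₖ)`. -/
def ricciCurvature {n : ℕ} (g : RSpace n → Matrix (Fin n) (Fin n) ℝ) (i j : Fin n)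
    (x : RSpace n) : ℝ :=
  ∑ k, (partialDeriv k (christoffel g k i j) x - partialDeriv j (christoffel g k i k) x)
    + ∑ k, ∑ l, (christoffel g k k l x * christoffel g l i j x
        - christoffel g k j l x * christoffel g l i k x)

/-- Scalar curvature `R_g = ∑ᵢⱼ gⁱʲ Rᵢⱼ`. -/
def scalarCurvature {n : ℕ} (g : RSpace n → Matrix (Fin n) (Fin n) ℝ) (x : RSpace n) : ℝ :=
  ∑ i, ∑ j, (g x)⁻¹ i j * ricciCurvature g i j x

/-! ### Conformal metrics on `ℝⁿ` -/

/-- The conformal metric `g = e^{2u} |dx|²`. -/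
def conformalMetric {n : ℕ} (u : RSpace n → ℝ) (x : RSpace n) : Matrix (Fin n) (Fin n) ℝ :=
  Real.exp (2 * u x) • (1 : Matrix (Fin n) (Fin n) ℝ)

/-- The Q-curvature of `e^{2u} |dx|²` for even `n`: the function `Q` with
`(-Δ)^{n/2} u = Q e^{nu}`. -/
def qCurvature {n : ℕ} (u : RSpace n → ℝ) (x : RSpace n) : ℝ :=
  ((fun f : RSpace n → ℝ => -Laplacian.laplacian f)^[n / 2] u) x * Real.exp (-(n * u x))

/-- Finite total Q-curvature: `Q e^{nu} ∈ L¹(ℝⁿ)`. -/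
def HasFiniteTotalQCurvature {n : ℕ} (u : RSpace n → ℝ) : Prop :=
  Integrable (fun x : RSpace n => qCurvature u x * Real.exp (n * u x))

/-- The metric `e^{2u} |dx|²` of finite total Q-curvature is normal:
`u(x) = 2 / ((n-1)! |𝕊ⁿ|) ∫ log (|y| / |x - y|) Q(y) e^{n u(y)} dy + C`. -/
def IsNormalMetric {n : ℕ} (u : RSpace n → ℝ) : Prop :=
  HasFiniteTotalQCurvature u ∧
  ∃ C : ℝ, ∀ x : RSpace n,
    u x = 2 / ((n - 1)! * sphereArea n) *
      (∫ y : RSpace n, Real.log (‖y‖ / ‖x - y‖) * (qCurvature u y * Real.exp (n * u y))) + C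

/-- The conformal mass `m_c(g)` of `g = e^{2u} |dx|²`, an extended real number:
`1 / ((n-1)(n-2)|𝕊ⁿ⁻¹|) inf_x liminf_{r → ∞} r^{3-n} ∫_{∂B_r(x)} R_g e^{2u} dσ`. -/
def conformalMass {n : ℕ} (u : RSpace n → ℝ) : EReal :=
  ((1 / (((n : ℝ) - 1) * ((n : ℝ) - 2) * sphereArea (n - 1)) : ℝ) : EReal) *
    ⨅ x : RSpace n, liminf (fun r : ℝ =>
      ((r ^ (3 - (n : ℤ)) * sphereIntegral
        (fun y => scalarCurvature (conformalMetric u) y * Real.exp (2 * u y)) x r : ℝ) : EReal)) atTop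

/-- The function `x ↦ (x · ∇Q) e^{nu}`. -/
def pohozaevDensity {n : ℕ} (u : RSpace n → ℝ) (x : RSpace n) : ℝ :=
  inner ℝ x (∇ (qCurvature u) x) * Real.exp (n * u x)

end

/-!
Put `f = Q e ^ (n u)`, so that `u` is up to a constant the logarithmic potential of `c f`, and
`α = c ∫ f`. The scalar curvature satisfies
`R_g e ^ (2 u) = -2 (n - 1) Δu - (n - 1) (n - 2) |∇u|²`. Rescaled to the unit sphere,
`r² Δu(x + r w) → -(n - 2) α` in mean and `r ∇u(x + r w) → -α w` in mean square: for fixed `y` the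
kernels converge as `r → ∞`, and the spherical means of `|w - z| ^ (-2)` are bounded uniformly in
`z` because `n ≥ 4`, so that dominated convergence applies to the integral over `y`. Hence the
limits in the definition of the mass exist for every center, and the mass is `α (2 - α)`.

On the other side, the divergence theorem turns `∫_{B_r} x · ∇Q e ^ (n u)` into the boundary flux of
`x f`, the integral of `f` over `B_r`, and a double integral of `x · (x - y) / |x - y|² f(x) f(y)`
over `x ∈ B_r`, `y ∈ ℝⁿ`. Exchanging `x` and `y` shows that the part over `B_r × B_r` is
`(∫_{B_r} f)² / 2`. The flux and the interaction between `B_r` and its complement need not tend to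
zero, but both are integrable with respect to `dr / r` on `(0, ∞)`, for the latter because
`∫_{|x| < r ≤ |y|} dr / r = log (|y| / |x|) ≤ |y - x| / |x|`; so they tend to zero simultaneously
along a sequence `r_k → ∞`. After multiplication by `-2 c / n` the limit along `r_k` is again
`α (2 - α)`, and it is that of the improper integral whenever the latter exists.
-/

section Curvature

variable {n : ℕ} {u : RSpace n → ℝ}

theorem differentiable_partialDeriv (hu : ContDiff ℝ 2 u) (i : Fin n) :
    Differentiable ℝ (partialDeriv i u) :=
  ((hu.fderiv_right (m := 1) (by norm_num)).clm_apply contDiff_const).differentiable one_ne_zero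

theorem partialDeriv_eq_gradient_apply (i : Fin n) (x : RSpace n) :
    partialDeriv i u x = ∇ u x i := by
  rw [partialDeriv, ← inner_gradient_left, EuclideanSpace.inner_single_right]
  simp

theorem partialDeriv_partialDeriv (hu : ContDiff ℝ 2 u) (i j : Fin n) (x : RSpace n) :
    partialDeriv i (partialDeriv j u) x =
      fderiv ℝ (fderiv ℝ u) x (EuclideanSpace.single i 1) (EuclideanSpace.single j 1) := by
  have hd : DifferentiableAt ℝ (fderiv ℝ u) x :=
    ((hu.fderiv_right (m := 1) (by norm_num)).differentiable one_ne_zero) x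
  have h : HasFDerivAt (fun y => fderiv ℝ u y (EuclideanSpace.single j 1)) _ x :=
    hd.hasFDerivAt.clm_apply (hasFDerivAt_const _ x)
  change fderiv ℝ (fun y => fderiv ℝ u y (EuclideanSpace.single j 1)) x _ = _
  rw [h.fderiv]
  simp

theorem partialDeriv_comm (hu : ContDiff ℝ 2 u) (i j : Fin n) (x : RSpace n) :
    partialDeriv i (partialDeriv j u) x = partialDeriv j (partialDeriv i u) x := by
  rw [partialDeriv_partialDeriv hu, partialDeriv_partialDeriv hu]
  exact (hu.contDiffAt.isSymmSndFDerivAt (by simp)).eq _ _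

theorem sum_partialDeriv_partialDeriv (hu : ContDiff ℝ 2 u) (x : RSpace n) :
    ∑ i, partialDeriv i (partialDeriv i u) x = Laplacian.laplacian u x := by
  rw [InnerProductSpace.laplacian_eq_iteratedFDeriv_orthonormalBasis u
    (EuclideanSpace.basisFun (Fin n) ℝ)]
  simp [partialDeriv_partialDeriv hu, iteratedFDeriv_two_apply]

theorem sum_partialDeriv_sq (x : RSpace n) : ∑ i, partialDeriv i u x ^ 2 = ‖∇ u x‖ ^ 2 := by
  simp only [partialDeriv_eq_gradient_apply, EuclideanSpace.real_norm_sq_eq]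

theorem conformalMetric_apply (x : RSpace n) (i j : Fin n) :
    conformalMetric u x i j = Real.exp (2 * u x) * if i = j then 1 else 0 := by
  simp [conformalMetric, Matrix.one_apply]

theorem conformalMetric_inv_apply (x : RSpace n) (i j : Fin n) :
    (conformalMetric u x)⁻¹ i j = (Real.exp (2 * u x))⁻¹ * if i = j then 1 else 0 := by
  have h : (conformalMetric u x)⁻¹ = (Real.exp (2 * u x))⁻¹ • (1 : Matrix (Fin n) (Fin n) ℝ) :=
    Matrix.inv_eq_left_inv (by simp [conformalMetric])
  simp [h, Matrix.one_apply]

theorem partialDeriv_conformalMetric (hu : Differentiable ℝ u) (l i j : Fin n) (x : RSpace n) :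
    partialDeriv l (fun y => conformalMetric u y i j) x
      = 2 * partialDeriv l u x * Real.exp (2 * u x) * if i = j then 1 else 0 := by
  simp only [conformalMetric_apply, partialDeriv]
  have h : HasFDerivAt (fun y => Real.exp (2 * u y) * if i = j then (1 : ℝ) else 0) _ x :=
    (((hu x).hasFDerivAt.const_mul 2).exp).mul_const _
  rw [h.fderiv]
  simp only [smul_apply, smul_eq_mul]
  ring

theorem christoffel_conformalMetric (hu : Differentiable ℝ u) (k i j : Fin n) :
    christoffel (conformalMetric u) k i j = fun x =>
      (if j = k then 1 else 0) * partialDeriv i u x + (if i = k then 1 else 0) * partialDeriv j u x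
        - (if i = j then 1 else 0) * partialDeriv k u x := by
  funext x
  simp only [christoffel, conformalMetric_inv_apply, partialDeriv_conformalMetric hu, mul_ite,
    mul_one, mul_zero, ite_mul, zero_mul, Finset.sum_ite_eq, Finset.mem_univ, if_true]
  split_ifs <;> field_simp <;> ring

theorem partialDeriv_christoffel_conformalMetric (hu : ContDiff ℝ 2 u) (l k i j : Fin n)
    (x : RSpace n) :
    partialDeriv l (christoffel (conformalMetric u) k i j) x =
      (if j = k then 1 else 0) * partialDeriv l (partialDeriv i u) x
        + (if i = k then 1 else 0) * partialDeriv l (partialDeriv j u) x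
        - (if i = j then 1 else 0) * partialDeriv l (partialDeriv k u) x := by
  rw [christoffel_conformalMetric (hu.differentiable two_ne_zero)]
  have d : ∀ i, HasFDerivAt (partialDeriv i u) (fderiv ℝ (partialDeriv i u) x) x := fun i =>
    (differentiable_partialDeriv hu i x).hasFDerivAt
  have h : HasFDerivAt (fun x => (if j = k then 1 else 0) * partialDeriv i u x
      + (if i = k then 1 else 0) * partialDeriv j u x
      - (if i = j then 1 else 0) * partialDeriv k u x) _ x :=
    (((d i).const_mul _).add ((d j).const_mul _)).sub ((d k).const_mul _)
  rw [partialDeriv, h.fderiv]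
  rfl

theorem sum_partialDeriv_christoffel_conformalMetric (hu : ContDiff ℝ 2 u) (i j : Fin n)
    (x : RSpace n) :
    ∑ k, (partialDeriv k (christoffel (conformalMetric u) k i j) x
        - partialDeriv j (christoffel (conformalMetric u) k i k) x)
      = (2 - n) * partialDeriv i (partialDeriv j u) x
        - (if i = j then 1 else 0) * Laplacian.laplacian u x := by
  simp only [partialDeriv_christoffel_conformalMetric hu, ← sum_partialDeriv_partialDeriv hu]
  simp only [ite_mul, one_mul, zero_mul, if_true, partialDeriv_comm hu j i, add_sub_cancel_right,
    Finset.sum_sub_distrib, Finset.sum_add_distrib, Finset.sum_ite_eq, Finset.mem_univ,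
    Finset.sum_ite_irrel, Finset.sum_const_zero, Finset.sum_const, Finset.card_univ,
    Fintype.card_fin, nsmul_eq_mul]
  ring

theorem sum_sum_christoffel_mul_christoffel_conformalMetric (hu : Differentiable ℝ u)
    (i j : Fin n) (x : RSpace n) :
    ∑ k, ∑ l, (christoffel (conformalMetric u) k k l x * christoffel (conformalMetric u) l i j x
        - christoffel (conformalMetric u) k j l x * christoffel (conformalMetric u) l i k x)
      = (n - 2) * (partialDeriv i u x * partialDeriv j u x
        - (if i = j then 1 else 0) * ‖∇ u x‖ ^ 2) := by
  simp only [christoffel_conformalMetric hu, ← sum_partialDeriv_sq, mul_sub, sub_mul, add_mul,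
    mul_add, Finset.sum_sub_distrib, Finset.sum_add_distrib, mul_ite, ite_mul, one_mul,
    zero_mul, mul_zero, Finset.sum_ite_eq, Finset.sum_ite_eq', Finset.mem_univ, if_true,
    Finset.sum_const, Finset.sum_ite_irrel]
  rcases eq_or_ne i j with rfl | hij
  · simp [← pow_two]
    ring
  · simp [hij, hij.symm]
    ring

theorem ricciCurvature_conformalMetric (hu : ContDiff ℝ 2 u) (i j : Fin n) (x : RSpace n) :
    ricciCurvature (conformalMetric u) i j x =
      -(n - 2) * (partialDeriv i (partialDeriv j u) x - partialDeriv i u x * partialDeriv j u x)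
        - (if i = j then 1 else 0) * (Laplacian.laplacian u x + (n - 2) * ‖∇ u x‖ ^ 2) := by
  rw [ricciCurvature, sum_partialDeriv_christoffel_conformalMetric hu,
    sum_sum_christoffel_mul_christoffel_conformalMetric (hu.differentiable two_ne_zero)]
  ring

theorem scalarCurvature_conformalMetric_mul_exp (hu : ContDiff ℝ 2 u) (x : RSpace n) :
    scalarCurvature (conformalMetric u) x * Real.exp (2 * u x) =
      -(2 * (n - 1)) * Laplacian.laplacian u x - (n - 1) * (n - 2) * ‖∇ u x‖ ^ 2 := by
  have htrace : scalarCurvature (conformalMetric u) x =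
      (Real.exp (2 * u x))⁻¹ * ∑ i, ricciCurvature (conformalMetric u) i i x := by
    simp [scalarCurvature, conformalMetric_inv_apply, Finset.mul_sum]
  rw [htrace, mul_right_comm, inv_mul_cancel₀ (Real.exp_ne_zero _), one_mul]
  simp only [ricciCurvature_conformalMetric hu, if_true, one_mul, ← pow_two,
    Finset.sum_sub_distrib, ← Finset.mul_sum, sum_partialDeriv_partialDeriv hu,
    sum_partialDeriv_sq, Finset.sum_const, Finset.card_univ, Fintype.card_fin, nsmul_eq_mul]
  ring

end Curvature

section WeaklySingularKernel

variable {E : Type*} [NormedAddCommGroup E] {p : ℕ} {K f : E → ℝ}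

/-- A weakly singular kernel of order `p`: continuous away from the origin and `O(‖z‖⁻ᵖ)` on all
of `E`. The value at the origin is constrained by the convention `‖0‖⁻¹ = 0`, which makes it `0`
when `0 < p`. -/
structure IsWeaklySingular (p : ℕ) (K : E → ℝ) : Prop where
  continuousOn : ContinuousOn K {0}ᶜ
  exists_abs_le : ∃ C, ∀ z, |K z| ≤ C * ‖z‖⁻¹ ^ p

theorem isWeaklySingular_inv_norm_pow (p : ℕ) : IsWeaklySingular p fun z : E => ‖z‖⁻¹ ^ p where
  continuousOn := (continuousOn_id.norm.inv₀ fun _ hz => norm_ne_zero_iff.2 hz).pow p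
  exists_abs_le := ⟨1, fun z => by rw [one_mul, abs_of_nonneg (by positivity)]⟩

theorem integrableOn_closedBall_inv_norm_pow [NormedSpace ℝ E] [FiniteDimensional ℝ E]
    [MeasurableSpace E] [BorelSpace E] {μ : Measure E} [μ.IsAddHaarMeasure]
    (hp : p < Module.finrank ℝ E) (R : ℝ) :
    IntegrableOn (fun z : E => ‖z‖⁻¹ ^ p) (closedBall 0 R) μ := by
  have := Module.nontrivial_of_finrank_pos (Nat.zero_lt_of_lt hp)
  refine IntegrableOn.mono_set ?_ (closedBall_subset_ball (lt_add_one R))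
  refine (integrableOn_fun_norm_addHaar μ (f := fun r : ℝ => r⁻¹ ^ p)).2 ?_
  have hpow : IntegrableOn (fun y : ℝ => y ^ (Module.finrank ℝ E - 1 - p)) (Set.Ioo 0 (R + 1)) :=
    (continuous_pow _).integrableOn_Icc.mono_set Set.Ioo_subset_Icc_self
  refine hpow.congr_fun (fun y hy => ?_) measurableSet_Ioo
  have hy0 : y ≠ 0 := hy.1.ne'
  simp only [smul_eq_mul]
  rw [inv_pow, ← div_eq_mul_inv, eq_div_iff (pow_ne_zero _ hy0), ← pow_add]
  congr 1
  omega

theorem ae_sub_add_smul_ne_zero [NormedSpace ℝ E] [FiniteDimensional ℝ E] [MeasurableSpace E]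
    [BorelSpace E] {μ : Measure E} [μ.IsAddHaarMeasure] (hE : 1 < Module.finrank ℝ E) (x v : E) :
    ∀ᵐ y ∂μ, ∀ s : ℝ, x - y + s • v ≠ 0 := by
  have hline : AffineSubspace.mk' x (ℝ ∙ v) ≠ ⊤ := fun h => by
    have hdim : Module.finrank ℝ (ℝ ∙ v) ≤ 1 := by simpa using finrank_span_le_card (R := ℝ) {v}
    rw [← AffineSubspace.direction_mk' x (ℝ ∙ v), h, AffineSubspace.direction_top, finrank_top]
      at hdim
    omega
  filter_upwards [compl_mem_ae_iff.2 (Measure.addHaar_affineSubspace μ _ hline)] with y hy s hs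
  refine hy (AffineSubspace.mem_mk'.2 (Submodule.mem_span_singleton.2 ⟨s, ?_⟩))
  rw [vsub_eq_sub, eq_sub_iff_add_eq, ← sub_eq_zero, ← hs]
  abel

namespace IsWeaklySingular

theorem abs (hK : IsWeaklySingular p K) : IsWeaklySingular p fun z => |K z| where
  continuousOn := hK.continuousOn.abs
  exists_abs_le := by simpa only [abs_abs] using hK.exists_abs_le

theorem exists_nonneg_abs_le (hK : IsWeaklySingular p K) :
    ∃ C, 0 ≤ C ∧ ∀ z, |K z| ≤ C * ‖z‖⁻¹ ^ p := by
  obtain ⟨C, hC⟩ := hK.exists_abs_le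
  exact ⟨|C|, abs_nonneg C, fun z => (hC z).trans (by gcongr; exact le_abs_self C)⟩

theorem exists_norm_cutoff_mul_le (hK : IsWeaklySingular p K) :
    ∃ C, 0 ≤ C ∧ ∀ z, ‖min 1 ‖z‖ ^ (p + 1) * K z‖ ≤ C * min 1 ‖z‖ := by
  obtain ⟨C, hC0, hC⟩ := hK.exists_nonneg_abs_le
  refine ⟨C, hC0, fun z => ?_⟩
  have hone : min 1 ‖z‖ * ‖z‖⁻¹ ≤ 1 := mul_inv_le_one_of_le₀ (min_le_right _ _) (norm_nonneg z)
  calc ‖min 1 ‖z‖ ^ (p + 1) * K z‖ = min 1 ‖z‖ ^ (p + 1) * |K z| := by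
        rw [norm_mul, Real.norm_of_nonneg (by positivity), Real.norm_eq_abs]
    _ ≤ min 1 ‖z‖ ^ (p + 1) * (C * ‖z‖⁻¹ ^ p) := by gcongr; exact hC z
    _ = C * min 1 ‖z‖ * (min 1 ‖z‖ * ‖z‖⁻¹) ^ p := by rw [mul_pow]; ring
    _ ≤ C * min 1 ‖z‖ * 1 := by gcongr; exact pow_le_one₀ (by positivity) hone
    _ = C * min 1 ‖z‖ := mul_one _

theorem continuous_cutoff_mul (hK : IsWeaklySingular p K) :
    Continuous fun z => min 1 ‖z‖ ^ (p + 1) * K z := by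
  obtain ⟨C, -, hC⟩ := hK.exists_norm_cutoff_mul_le
  refine continuous_iff_continuousAt.2 fun z => ?_
  rcases eq_or_ne z 0 with rfl | hz
  · have hlim : Tendsto (fun z : E => C * min 1 ‖z‖) (𝓝 0) (𝓝 0) := by
      have hcont : Continuous fun z : E => C * min 1 ‖z‖ := by fun_prop
      simpa using hcont.tendsto 0
    simpa [ContinuousAt] using squeeze_zero_norm hC hlim
  · exact ContinuousAt.mul (by fun_prop)
      (hK.continuousOn.continuousAt (isOpen_compl_singleton.mem_nhds hz))

theorem integral_segment_eq_sub [NormedSpace ℝ E] {k : E → ℝ} {v : E} (hK : IsWeaklySingular p K)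
    (hk : ∀ z, z ≠ 0 → HasLineDerivAt ℝ k (K z) z v) {w : E} (hw : ∀ s : ℝ, w + s • v ≠ 0)
    (t : ℝ) :
    ∫ s in (0 : ℝ)..t, K (w + s • v) = k (w + t • v) - k w := by
  have hderiv : ∀ s : ℝ, HasDerivAt (fun s => k (w + s • v)) (K (w + s • v)) s := fun s => by
    have h := HasDerivAt.comp_sub_const s s (by simpa [HasLineDerivAt] using hk _ (hw s))
    simpa only [add_assoc, ← add_smul, add_sub_cancel] using h
  have hcont : Continuous fun s : ℝ => K (w + s • v) :=
    hK.continuousOn.comp_continuous (by fun_prop) hw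
  simpa using intervalIntegral.integral_eq_sub_of_hasDerivAt (fun s _ => hderiv s)
    (hcont.intervalIntegrable 0 t)

variable [MeasurableSpace E] [BorelSpace E]

theorem measurable (hK : IsWeaklySingular p K) : Measurable K :=
  measurable_of_continuousOn_compl_singleton 0 hK.continuousOn

theorem integrable_cutoff_sub_mul (hK : IsWeaklySingular p K) {μ : Measure E}
    (hfi : Integrable f μ) (x : E) :
    Integrable (fun y => min 1 ‖x - y‖ ^ (p + 1) * K (x - y) * f y) μ := by
  obtain ⟨C, hC0, hC⟩ := hK.exists_norm_cutoff_mul_le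
  have hcont : Continuous fun y => x - y := by fun_prop
  exact hfi.bdd_mul (c := C) (hK.continuous_cutoff_mul.comp hcont).aestronglyMeasurable
    (Eventually.of_forall fun y =>
      (hC (x - y)).trans (mul_le_of_le_one_right hC0 (min_le_left _ _)))

theorem continuous_integral_cutoff_sub_mul (hK : IsWeaklySingular p K) {μ : Measure E}
    (hfi : Integrable f μ) :
    Continuous fun x => ∫ y, min 1 ‖x - y‖ ^ (p + 1) * K (x - y) * f y ∂μ := by
  obtain ⟨C, hC0, hC⟩ := hK.exists_norm_cutoff_mul_le
  have hbdd : BddAbove (Set.range fun z => ‖min 1 ‖z‖ ^ (p + 1) * K z‖) :=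
    ⟨C, by rintro _ ⟨z, rfl⟩; exact (hC z).trans (mul_le_of_le_one_right hC0 (min_le_left _ _))⟩
  refine (hbdd.continuous_convolution_right_of_integrable (ContinuousLinearMap.mul ℝ ℝ) hfi
    hK.continuous_cutoff_mul).congr fun x => ?_
  simp only [convolution, ContinuousLinearMap.mul_apply', mul_comm (f _)]

variable [NormedSpace ℝ E] [FiniteDimensional ℝ E] {μ : Measure E} [μ.IsAddHaarMeasure]

theorem integrableOn_closedBall (hK : IsWeaklySingular p K) (hp : p < Module.finrank ℝ E) (R : ℝ) :
    IntegrableOn K (closedBall 0 R) μ := by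
  obtain ⟨C, hC⟩ := hK.exists_abs_le
  exact ((integrableOn_closedBall_inv_norm_pow hp R).const_mul C).mono'
    hK.measurable.aestronglyMeasurable (Eventually.of_forall hC)

theorem integrable_mul_comp_sub (hK : IsWeaklySingular p K) (hp : p < Module.finrank ℝ E)
    (hf : Continuous f) (hfi : Integrable f μ) (x : E) :
    Integrable (fun z => K z * f (x - z)) μ := by
  obtain ⟨C, hC0, hC⟩ := hK.exists_nonneg_abs_le
  rw [← integrableOn_univ, ← Set.union_compl_self (closedBall 0 1), integrableOn_union]
  refine ⟨(hK.integrableOn_closedBall hp 1).mul_continuousOn (by fun_prop)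
    (isCompact_closedBall 0 1), (hfi.comp_sub_left x).integrableOn.bdd_mul (c := C)
      hK.measurable.aestronglyMeasurable ?_⟩
  filter_upwards [ae_restrict_mem measurableSet_closedBall.compl] with z hz
  have hz1 : 1 ≤ ‖z‖ := by simpa using (not_le.1 (by simpa using hz)).le
  exact (hC z).trans (mul_le_of_le_one_right hC0
    (pow_le_one₀ (by positivity) (inv_le_one_of_one_le₀ hz1)))

theorem integrable_sub_mul (hK : IsWeaklySingular p K) (hp : p < Module.finrank ℝ E)
    (hf : Continuous f) (hfi : Integrable f μ) (x : E) :
    Integrable (fun y => K (x - y) * f y) μ := by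
  simpa using (hK.integrable_mul_comp_sub hp hf hfi x).comp_sub_left x

theorem continuous_integral_mul_near (hK : IsWeaklySingular p K) (hp : p < Module.finrank ℝ E)
    (hf : Continuous f) :
    Continuous fun x => ∫ z, K z * ((1 - min 1 ‖z‖ ^ (p + 1)) * f (x - z)) ∂μ := by
  rw [← continuousOn_univ]
  refine continuousOn_integral_bilinear_of_locally_integrable_of_compact_support
    (ContinuousLinearMap.mul ℝ ℝ) (f := fun x z => (1 - min 1 ‖z‖ ^ (p + 1)) * f (x - z))
    (isCompact_closedBall 0 1) (by fun_prop) (fun x z _ hz => ?_) (hK.integrableOn_closedBall hp 1)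
  have hz1 : 1 < ‖z‖ := by simpa using hz
  simp [min_eq_left hz1.le]

theorem continuous_integral_sub_mul (hK : IsWeaklySingular p K) (hp : p < Module.finrank ℝ E)
    (hf : Continuous f) (hfi : Integrable f μ) :
    Continuous fun x => ∫ y, K (x - y) * f y ∂μ := by
  -- The near part is an integrable kernel of bounded support against the continuous `f`, the far
  -- part a bounded continuous kernel against the integrable `f`.
  have hsplit : ∀ x, ∫ y, K (x - y) * f y ∂μ =
      (∫ z, K z * ((1 - min 1 ‖z‖ ^ (p + 1)) * f (x - z)) ∂μ)
        + ∫ y, min 1 ‖x - y‖ ^ (p + 1) * K (x - y) * f y ∂μ := fun x => by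
    rw [← sub_eq_iff_eq_add, ← integral_sub (hK.integrable_sub_mul hp hf hfi x)
      (hK.integrable_cutoff_sub_mul hfi x), ← integral_sub_left_eq_self _ μ x]
    simp only [sub_sub_cancel]
    congr 1
    funext z
    ring
  simp only [hsplit]
  exact (hK.continuous_integral_mul_near hp hf).add (hK.continuous_integral_cutoff_sub_mul hfi)

theorem integrable_prod_segment (hK : IsWeaklySingular p K) (hp : p < Module.finrank ℝ E)
    (hf : Continuous f) (hfi : Integrable f μ) (x v : E) (t : ℝ) :
    Integrable (Function.uncurry fun s y => K (x + s • v - y) * f y)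
      ((volume.restrict (Set.uIoc 0 t)).prod μ) := by
  have hm : Measurable (Function.uncurry fun (s : ℝ) y => K (x + s • v - y) * f y) :=
    (hK.measurable.comp (by fun_prop)).mul (hf.measurable.comp measurable_snd)
  refine (integrable_prod_iff hm.aestronglyMeasurable).2
    ⟨Eventually.of_forall fun s => hK.integrable_sub_mul hp hf hfi (x + s • v), ?_⟩
  have hcont : Continuous fun s : ℝ => ∫ y, |K (x + s • v - y)| * |f y| ∂μ :=
    (hK.abs.continuous_integral_sub_mul hp hf.abs hfi.abs).comp (by fun_prop)
  simpa [abs_mul] using hcont.integrableOn_uIoc.integrable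

theorem ae_intervalIntegral_segment_mul {k : E → ℝ} {v : E} (hE : 1 < Module.finrank ℝ E)
    (hK : IsWeaklySingular p K) (hk : ∀ z, z ≠ 0 → HasLineDerivAt ℝ k (K z) z v) (x : E) (t : ℝ) :
    ∀ᵐ y ∂μ, ∫ s in (0 : ℝ)..t, K (x + s • v - y) * f y
      = (k (x + t • v - y) - k (x - y)) * f y := by
  filter_upwards [ae_sub_add_smul_ne_zero hE x v] with y hy
  simp only [add_sub_right_comm, intervalIntegral.integral_mul_const,
    hK.integral_segment_eq_sub hk hy]

theorem integrable_primitive_sub_mul {k : E → ℝ} {v : E} (hE : 1 < Module.finrank ℝ E)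
    (hp : p < Module.finrank ℝ E) (hK : IsWeaklySingular p K)
    (hk : ∀ z, z ≠ 0 → HasLineDerivAt ℝ k (K z) z v) (hf : Continuous f) (hfi : Integrable f μ)
    (x : E) (t : ℝ) :
    Integrable (fun y => (k (x + t • v - y) - k (x - y)) * f y) μ := by
  refine Integrable.congr ?_ (ae_intervalIntegral_segment_mul hE hK hk x t)
  simp only [intervalIntegral.intervalIntegral_eq_integral_uIoc]
  exact (hK.integrable_prod_segment hp hf hfi x v t).integral_prod_right.smul
    (if 0 ≤ t then (1 : ℝ) else -1)

theorem hasDerivAt_integral_primitive_sub_mul {k : E → ℝ} {v : E} (hE : 1 < Module.finrank ℝ E)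
    (hp : p < Module.finrank ℝ E) (hK : IsWeaklySingular p K)
    (hk : ∀ z, z ≠ 0 → HasLineDerivAt ℝ k (K z) z v) (hf : Continuous f) (hfi : Integrable f μ)
    (x : E) :
    HasDerivAt (fun t : ℝ => ∫ y, (k (x + t • v - y) - k (x - y)) * f y ∂μ)
      (∫ y, K (x - y) * f y ∂μ) 0 := by
  -- Near `x` the kernel has no integrable bound uniform in `t`, so instead of differentiating under
  -- the integral sign we differentiate the integral of a continuous function along the segment.
  have hcont : Continuous fun s : ℝ => ∫ y, K (x + s • v - y) * f y ∂μ :=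
    (hK.continuous_integral_sub_mul hp hf hfi).comp (by fun_prop)
  have hfubini : ∀ t : ℝ, ∫ y, (k (x + t • v - y) - k (x - y)) * f y ∂μ
      = ∫ s in (0 : ℝ)..t, ∫ y, K (x + s • v - y) * f y ∂μ := fun t => by
    rw [intervalIntegral_integral_swap (hK.integrable_prod_segment hp hf hfi x v t)]
    exact (integral_congr_ae (ae_intervalIntegral_segment_mul hE hK hk x t)).symm
  simp only [hfubini]
  simpa using (hcont.integral_hasStrictDerivAt 0 0).hasDerivAt

end IsWeaklySingular

end WeaklySingularKernel

section LogPotential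

open EuclideanGeometry

variable {E : Type*} [NormedAddCommGroup E] [InnerProductSpace ℝ E]

theorem inversion_zero_one (z : E) : inversion 0 1 z = ‖z‖⁻¹ ^ 2 • z := by
  simp [inversion]

theorem norm_inversion_zero_one (z : E) : ‖inversion 0 1 z‖ = ‖z‖⁻¹ := by
  simpa using dist_inversion_center (0 : E) z 1

theorem hasLineDerivAt_log_norm {z : E} (hz : z ≠ 0) (v : E) :
    HasLineDerivAt ℝ (fun z : E => Real.log ‖z‖) (inner ℝ (inversion 0 1 z) v) z v := by
  have h := ((hasStrictFDerivAt_norm_sq z).hasFDerivAt.log (by positivity)).const_mul (1 / 2)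
  have hlog : (fun z : E => 1 / 2 * Real.log (‖z‖ ^ 2)) = fun z => Real.log ‖z‖ := by
    funext y; rw [Real.log_pow]; push_cast; ring
  rw [hlog] at h
  convert h.hasLineDerivAt v using 1
  simp only [inversion_zero_one, inv_pow, inner_smul_left, map_inv₀, Real.ringHom_apply, one_div,
    smul_apply, coe_innerSL_apply, nsmul_eq_mul, Nat.cast_ofNat, smul_eq_mul]
  ring

theorem hasLineDerivAt_inner_inversion {z : E} (hz : z ≠ 0) (v : E) :
    HasLineDerivAt ℝ (fun z => inner ℝ (inversion 0 1 z) v)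
      (‖z‖⁻¹ ^ 2 * (‖v‖ ^ 2 - 2 * (‖z‖⁻¹ * inner ℝ z v) ^ 2)) z v := by
  have h := ((hasFDerivAt_inversion (R := 1) hz).inner ℝ (hasFDerivAt_const v z)).hasLineDerivAt v
  convert h using 1
  have hz' := norm_ne_zero_iff.2 hz
  simp only [inv_pow, dist_zero_right, one_div, sub_zero, ContinuousLinearMap.comp_apply,
    ContinuousLinearMap.prod_apply, smul_apply, ContinuousLinearEquiv.coe_coe,
    LinearIsometryEquiv.coe_toContinuousLinearEquiv, Submodule.reflection_orthogonal_apply,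
    Submodule.reflection_singleton_apply, Real.ringHom_apply, two_smul, neg_sub, zero_apply,
    fderivInnerCLM_apply, inner_zero_right, inner_smul_left, map_inv₀, inner_sub_left,
    inner_self_eq_norm_sq_to_K, inner_add_left, map_div₀, zero_add]
  field_simp
  ring

theorem isWeaklySingular_inner_inversion (v : E) :
    IsWeaklySingular 1 fun z : E => inner ℝ (inversion 0 1 z) v where
  continuousOn := by
    simp only [inversion_zero_one]
    exact (((isWeaklySingular_inv_norm_pow 2).continuousOn).smul continuousOn_id).inner
      continuousOn_const
  exists_abs_le := ⟨‖v‖, fun z => by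
    simpa [norm_inversion_zero_one, mul_comm] using abs_real_inner_le_norm (inversion 0 1 z) v⟩

theorem sq_inv_norm_mul_inner_le (z v : E) : (‖z‖⁻¹ * inner ℝ z v) ^ 2 ≤ ‖v‖ ^ 2 := by
  rw [sq_le_sq, abs_mul, abs_of_nonneg (inv_nonneg.2 (norm_nonneg z)), abs_norm]
  calc ‖z‖⁻¹ * |inner ℝ z v| ≤ ‖z‖⁻¹ * (‖z‖ * ‖v‖) := by gcongr; exact abs_real_inner_le_norm z v
    _ = (‖z‖⁻¹ * ‖z‖) * ‖v‖ := by ring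
    _ ≤ ‖v‖ := mul_le_of_le_one_left (norm_nonneg v) inv_mul_le_one

theorem isWeaklySingular_lineDeriv_inner_inversion (v : E) :
    IsWeaklySingular 2 fun z : E =>
      ‖z‖⁻¹ ^ 2 * (‖v‖ ^ 2 - 2 * (‖z‖⁻¹ * inner ℝ z v) ^ 2) where
  continuousOn := by
    have hinv : ContinuousOn (fun z : E => ‖z‖⁻¹) {0}ᶜ := by
      simpa using (isWeaklySingular_inv_norm_pow (E := E) 1).continuousOn
    fun_prop
  exists_abs_le := ⟨‖v‖ ^ 2, fun z => by
    rw [abs_mul, abs_of_nonneg (by positivity : 0 ≤ ‖z‖⁻¹ ^ 2), mul_comm]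
    have h := sq_inv_norm_mul_inner_le z v
    gcongr
    exact abs_le.2 ⟨by linarith, by linarith [sq_nonneg (‖z‖⁻¹ * inner ℝ z v)]⟩⟩

theorem sum_lineDeriv_inner_inversion {ι : Type*} [Fintype ι] (b : OrthonormalBasis ι ℝ E) (z : E) :
    ∑ i, ‖z‖⁻¹ ^ 2 * (‖b i‖ ^ 2 - 2 * (‖z‖⁻¹ * inner ℝ z (b i)) ^ 2)
      = (Module.finrank ℝ E - 2) * ‖z‖⁻¹ ^ 2 := by
  rcases eq_or_ne z 0 with rfl | hz
  · simp
  have hz' := norm_ne_zero_iff.2 hz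
  simp only [mul_pow, b.norm_eq_one, ← Finset.mul_sum, Finset.sum_sub_distrib,
    b.sum_sq_inner_left, Finset.sum_const, Finset.card_univ,
    ← Module.finrank_eq_card_basis b.toBasis]
  simp only [inv_pow, one_pow, nsmul_eq_mul, mul_one]
  field_simp

variable [FiniteDimensional ℝ E] [MeasurableSpace E] [BorelSpace E] {μ : Measure E}
  [μ.IsAddHaarMeasure] {f u : E → ℝ} {c : ℝ}

/-- Up to an additive constant, `u` is `c` times the logarithmic potential of the density `f`,
normalized so that the kernel vanishes at `x = 0`. -/
def IsLogPotential (μ : Measure E) (c : ℝ) (f u : E → ℝ) : Prop :=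
  ∃ C : ℝ, ∀ x, u x = c * (∫ y, Real.log (‖y‖ / ‖x - y‖) * f y ∂μ) + C

theorem log_norm_div_norm_sub_ae_eq [Nontrivial E] (x : E) :
    (fun y => Real.log (‖y‖ / ‖x - y‖)) =ᵐ[μ] fun y => Real.log ‖y‖ - Real.log ‖x - y‖ := by
  filter_upwards [Measure.ae_ne μ x, Measure.ae_ne μ 0] with y hy hy0
  rw [Real.log_div (norm_ne_zero_iff.2 hy0) (norm_ne_zero_iff.2 (sub_ne_zero.2 hy.symm))]

theorem integrable_log_mul (hE : 1 < Module.finrank ℝ E) (hf : Continuous f) (hfi : Integrable f μ)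
    (x : E) : Integrable (fun y => Real.log (‖y‖ / ‖x - y‖) * f y) μ := by
  have := Module.nontrivial_of_finrank_pos (Nat.zero_lt_of_lt hE)
  refine ((isWeaklySingular_inner_inversion (-x)).integrable_primitive_sub_mul hE hE
    (fun z hz => hasLineDerivAt_log_norm hz _) hf hfi x 1).congr ?_
  filter_upwards [log_norm_div_norm_sub_ae_eq x] with y hy
  simp [hy]

theorem integrable_smul_inversion (hE : 1 < Module.finrank ℝ E) (hf : Continuous f)
    (hfi : Integrable f μ) (x : E) : Integrable (fun y => f y • inversion 0 1 (x - y)) μ := by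
  refine ((isWeaklySingular_inv_norm_pow 1).integrable_sub_mul hE hf.abs hfi.abs x).mono' ?_ ?_
  · simp only [inversion_zero_one]
    exact (hf.measurable.smul (by fun_prop)).aestronglyMeasurable
  · exact Eventually.of_forall fun y => by
      simp [norm_smul, norm_inversion_zero_one, mul_comm]

namespace IsLogPotential

theorem sub_eq (hE : 1 < Module.finrank ℝ E) (hf : Continuous f) (hfi : Integrable f μ)
    (hu : IsLogPotential μ c f u) (x x' : E) :
    u x' - u x = -c * ∫ y, (Real.log ‖x' - y‖ - Real.log ‖x - y‖) * f y ∂μ := by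
  have := Module.nontrivial_of_finrank_pos (Nat.zero_lt_of_lt hE)
  obtain ⟨C, hC⟩ := hu
  rw [hC, hC, add_sub_add_right_eq_sub, ← mul_sub, ← integral_sub (integrable_log_mul hE hf hfi _)
    (integrable_log_mul hE hf hfi _), neg_mul, ← mul_neg, ← integral_neg]
  congr 1
  refine integral_congr_ae ?_
  filter_upwards [log_norm_div_norm_sub_ae_eq x, log_norm_div_norm_sub_ae_eq x'] with y hy hy'
  rw [hy, hy']
  ring

theorem hasLineDerivAt (hE : 1 < Module.finrank ℝ E) (hf : Continuous f) (hfi : Integrable f μ)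
    (hu : IsLogPotential μ c f u) (x v : E) :
    HasLineDerivAt ℝ u (-c * ∫ y, inner ℝ (inversion 0 1 (x - y)) v * f y ∂μ) x v := by
  have h := (((isWeaklySingular_inner_inversion v).hasDerivAt_integral_primitive_sub_mul hE hE
    (fun z hz => hasLineDerivAt_log_norm hz v) hf hfi x).const_mul (-c)).const_add (u x)
  simp only [← hu.sub_eq hE hf hfi, add_sub_cancel] at h
  exact h

theorem fderiv_apply (hE : 1 < Module.finrank ℝ E) (hf : Continuous f) (hfi : Integrable f μ)
    (hu : IsLogPotential μ c f u) {x : E} (hux : DifferentiableAt ℝ u x) (v : E) :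
    fderiv ℝ u x v = -c * ∫ y, inner ℝ (inversion 0 1 (x - y)) v * f y ∂μ :=
  hux.hasFDerivAt.hasLineDerivAt v |>.unique (hu.hasLineDerivAt hE hf hfi x v)

theorem gradient_eq (hE : 1 < Module.finrank ℝ E) (hf : Continuous f) (hfi : Integrable f μ)
    (hu : IsLogPotential μ c f u) {x : E} (hux : DifferentiableAt ℝ u x) :
    ∇ u x = -c • ∫ y, f y • inversion 0 1 (x - y) ∂μ := by
  refine ext_inner_right ℝ fun v => ?_
  rw [inner_gradient_left, hu.fderiv_apply hE hf hfi hux, inner_smul_left, real_inner_comm,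
    ← integral_inner (integrable_smul_inversion hE hf hfi x)]
  simp [inner_smul_right, real_inner_comm, mul_comm]

theorem fderiv_fderiv_apply_self (hE : 2 < Module.finrank ℝ E) (hf : Continuous f)
    (hfi : Integrable f μ) (hu : IsLogPotential μ c f u) (hu2 : ContDiff ℝ 2 u) (x v : E) :
    fderiv ℝ (fderiv ℝ u) x v v =
      -c * ∫ y, ‖x - y‖⁻¹ ^ 2 * (‖v‖ ^ 2 - 2 * (‖x - y‖⁻¹ * inner ℝ (x - y) v) ^ 2) * f y ∂μ := by
  have hE1 : 1 < Module.finrank ℝ E := by omega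
  have hint := (isWeaklySingular_inner_inversion v).integrable_sub_mul hE1 hf hfi
  have hd : DifferentiableAt ℝ (fderiv ℝ u) x :=
    (hu2.fderiv_right (m := 1) (by norm_num)).differentiable one_ne_zero x
  have h₁ : HasLineDerivAt ℝ (fun x => fderiv ℝ u x v) (fderiv ℝ (fderiv ℝ u) x v v) x v := by
    simpa using (hd.hasFDerivAt.clm_apply (hasFDerivAt_const v x)).hasLineDerivAt v
  have h₂ := (((isWeaklySingular_lineDeriv_inner_inversion v).hasDerivAt_integral_primitive_sub_mul
    hE1 hE (fun z hz => hasLineDerivAt_inner_inversion hz v) hf hfi x).const_mul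
      (-c)).const_add (fderiv ℝ u x v)
  refine h₁.unique (h₂.congr_of_eventuallyEq (Eventually.of_forall fun t => ?_))
  simp only [sub_mul, hu.fderiv_apply hE1 hf hfi (hu2.differentiable two_ne_zero _)]
  rw [integral_sub (hint _) (hint _)]
  ring

theorem laplacian_eq (hE : 2 < Module.finrank ℝ E) (hf : Continuous f) (hfi : Integrable f μ)
    (hu : IsLogPotential μ c f u) (hu2 : ContDiff ℝ 2 u) (x : E) :
    Laplacian.laplacian u x = -(c * (Module.finrank ℝ E - 2)) * ∫ y, ‖x - y‖⁻¹ ^ 2 * f y ∂μ := by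
  rw [InnerProductSpace.laplacian_eq_iteratedFDeriv_stdOrthonormalBasis]
  simp only [iteratedFDeriv_two_apply, Matrix.cons_val_zero, Matrix.cons_val_one,
    hu.fderiv_fderiv_apply_self hE hf hfi hu2]
  rw [← Finset.mul_sum, ← integral_finsetSum _ fun i _ =>
    (isWeaklySingular_lineDeriv_inner_inversion _).integrable_sub_mul hE hf hfi x]
  simp only [← Finset.sum_mul, sum_lineDeriv_inner_inversion]
  simp only [mul_assoc, integral_const_mul]
  ring

end IsLogPotential

end LogPotential

section Sphere

variable {E : Type*} [NormedAddCommGroup E] [NormedSpace ℝ E] [FiniteDimensional ℝ E]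
  [MeasurableSpace E] [BorelSpace E] {μ : Measure E} [μ.IsAddHaarMeasure]

theorem measurePreserving_coe_volumeIoiPow (k : ℕ) :
    MeasurePreserving (Subtype.val : Set.Ioi (0 : ℝ) → ℝ) (Measure.volumeIoiPow k)
      ((volume.restrict (Set.Ioi 0)).withDensity fun r => ENNReal.ofReal (r ^ k)) := by
  refine ⟨measurable_subtype_coe, Measure.ext fun s hs => ?_⟩
  rw [Measure.map_apply measurable_subtype_coe hs, Measure.volumeIoiPow,
    withDensity_apply _ (measurable_subtype_coe hs), withDensity_apply _ hs,
    ← lintegral_indicator (measurable_subtype_coe hs), ← lintegral_indicator hs]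
  exact lintegral_subtype_comap measurableSet_Ioi (s.indicator fun r => ENNReal.ofReal (r ^ k))

variable (μ) in
theorem measurePreserving_smul_sphere [Nontrivial E] :
    MeasurePreserving (fun p : sphere (0 : E) 1 × ℝ => p.2 • (p.1 : E))
      (μ.toSphere.prod ((volume.restrict (Set.Ioi 0)).withDensity fun r =>
        ENNReal.ofReal (r ^ (Module.finrank ℝ E - 1)))) μ := by
  have hcoe := (MeasurePreserving.id μ.toSphere).prod
    (measurePreserving_coe_volumeIoiPow (Module.finrank ℝ E - 1))
  have hpolar : MeasurePreserving (fun p => ((homeomorphUnitSphereProd E).symm p : E))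
      (μ.toSphere.prod (Measure.volumeIoiPow (Module.finrank ℝ E - 1))) μ := by
    have hval : MeasurePreserving (Subtype.val : ({0}ᶜ : Set E) → E) (μ.comap (↑)) μ :=
      ⟨measurable_subtype_coe, by
        rw [map_comap_subtype_coe (measurableSet_singleton _).compl, restrict_compl_singleton]⟩
    exact hval.comp (μ.measurePreserving_homeomorphUnitSphereProd.symm
      (homeomorphUnitSphereProd E).toMeasurableEquiv)
  have hm : Measurable fun p : sphere (0 : E) 1 × ℝ => p.2 • (p.1 : E) := by fun_prop
  refine ⟨hm, ?_⟩
  rw [← hcoe.map_eq, Measure.map_map hm hcoe.measurable]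
  convert hpolar.map_eq using 2
  funext p
  simp

theorem lintegral_polar [Nontrivial E] {g : E → ENNReal} (hg : Measurable g) :
    ∫⁻ x, g x ∂μ = ∫⁻ w, (∫⁻ r in Set.Ioi (0 : ℝ),
      ENNReal.ofReal (r ^ (Module.finrank ℝ E - 1)) * g (r • (w : E))) ∂μ.toSphere := by
  rw [← (measurePreserving_smul_sphere μ).lintegral_comp hg, lintegral_prod _ (by fun_prop)]
  congr 1 with w
  exact lintegral_withDensity_eq_lintegral_mul _ (by fun_prop) (by fun_prop)

theorem integral_polar [Nontrivial E] {g : E → ℝ} (hg : Integrable g μ) :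
    ∫ x, g x ∂μ = ∫ w, (∫ r in Set.Ioi (0 : ℝ),
      r ^ (Module.finrank ℝ E - 1) * g (r • (w : E))) ∂μ.toSphere := by
  have h := measurePreserving_smul_sphere μ
  conv_lhs => rw [← h.map_eq]
  have hgp : Integrable (fun p : sphere (0 : E) 1 × ℝ => g (p.2 • (p.1 : E))) _ :=
    h.integrable_comp_of_integrable hg
  rw [integral_map h.aemeasurable (h.map_eq.symm ▸ hg.1), integral_prod _ hgp]
  congr 1 with w
  rw [integral_withDensity_eq_integral_toReal_smul (by fun_prop)
    (Eventually.of_forall fun _ => ENNReal.ofReal_lt_top)]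
  refine setIntegral_congr_fun measurableSet_Ioi fun r (hr : 0 < r) => ?_
  rw [ENNReal.toReal_ofReal (by positivity), smul_eq_mul]

theorem setIntegral_ball_polar [Nontrivial E] {g : E → ℝ} {R : ℝ}
    (hg : IntegrableOn g (ball 0 R) μ) :
    ∫ x in ball 0 R, g x ∂μ = ∫ w, (∫ r in Set.Ioo 0 R,
      r ^ (Module.finrank ℝ E - 1) * g (r • (w : E))) ∂μ.toSphere := by
  rw [← integral_indicator measurableSet_ball,
    integral_polar ((integrable_indicator_iff measurableSet_ball).2 hg)]
  congr 1 with w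
  rw [← Set.Ioi_inter_Iio, ← setIntegral_indicator measurableSet_Iio]
  refine setIntegral_congr_fun measurableSet_Ioi fun r (hr : 0 < r) => ?_
  simp [Set.indicator, norm_smul, abs_of_pos hr]

omit [NormedSpace ℝ E] [FiniteDimensional ℝ E] in
theorem lintegral_inv_norm_sub_pow_le (p : ℕ) (s : Set E) (z : E) :
    ∫⁻ x in s, ENNReal.ofReal (‖x - z‖⁻¹ ^ p) ∂μ ≤
      ∫⁻ x in closedBall 0 1, ENNReal.ofReal (‖x‖⁻¹ ^ p) ∂μ + μ s := by
  have hball : ∫⁻ x in closedBall z 1, ENNReal.ofReal (‖x - z‖⁻¹ ^ p) ∂μ =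
      ∫⁻ x in closedBall 0 1, ENNReal.ofReal (‖x‖⁻¹ ^ p) ∂μ := by
    simp only [← lintegral_indicator measurableSet_closedBall]
    conv_rhs => rw [← lintegral_sub_right_eq_self _ z]
    simp [Set.indicator, dist_eq_norm]
  rw [← lintegral_inter_add_sdiff _ s (measurableSet_closedBall (x := z) (ε := 1)), ← hball]
  gcongr
  · exact Set.inter_subset_right
  · refine (setLIntegral_mono measurable_one fun x hx => ?_).trans
      ((setLIntegral_one _).trans_le (measure_mono Set.sdiff_subset))
    have hx' : 1 < ‖x - z‖ := by simpa [dist_eq_norm] using hx.2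
    exact ENNReal.ofReal_le_one.2 (pow_le_one₀ (by positivity) (inv_le_one_of_one_le₀ hx'.le))

omit [FiniteDimensional ℝ E] [MeasurableSpace E] [BorelSpace E] in
theorem ofReal_inv_norm_sub_pow_le (p k : ℕ) {w : E} (hw : ‖w‖ = 1) (z : E) :
    ENNReal.ofReal (‖w - z‖⁻¹ ^ p) ≤ 1 + 2 ^ (p + 1) * ∫⁻ r in Set.Ioo (1 : ℝ) 2,
      ENNReal.ofReal (r ^ k) * ENNReal.ofReal (‖r • w - z‖⁻¹ ^ (p + 1)) := by
  set d := ‖w - z‖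
  rcases le_or_gt d⁻¹ 1 with hd | hd
  · exact le_add_right (ENNReal.ofReal_le_one.2 (pow_le_one₀ (by positivity) hd))
  obtain ⟨hd0, hd1⟩ := one_lt_inv_iff₀.1 hd
  -- Moving `w` radially by less than `d` at most doubles its distance to `z`.
  have hnear : ∀ r ∈ Set.Ioo 1 (1 + d), ENNReal.ofReal ((2 * d)⁻¹ ^ (p + 1)) ≤
      ENNReal.ofReal (r ^ k) * ENNReal.ofReal (‖r • w - z‖⁻¹ ^ (p + 1)) := by
    rintro r ⟨hr1, hrd⟩
    have hdist : ‖(r • w - z) - (w - z)‖ = r - 1 := by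
      have hsmul : (r • w - z) - (w - z) = (r - 1) • w := by module
      rw [hsmul, norm_smul, hw, mul_one, Real.norm_of_nonneg (by linarith)]
    have hpos : 0 < ‖r • w - z‖ := by
      linarith [norm_sub_norm_le (w - z) (r • w - z), norm_sub_rev (w - z) (r • w - z)]
    have hle : ‖r • w - z‖ ≤ 2 * d := by linarith [norm_sub_norm_le (r • w - z) (w - z)]
    rw [← ENNReal.ofReal_mul (by positivity)]
    exact ENNReal.ofReal_le_ofReal <| calc
      (2 * d)⁻¹ ^ (p + 1) ≤ ‖r • w - z‖⁻¹ ^ (p + 1) := by gcongr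
      _ ≤ _ := le_mul_of_one_le_left (by positivity) (one_le_pow₀ hr1.le)
  refine le_add_left ?_
  calc ENNReal.ofReal (d⁻¹ ^ p)
      = 2 ^ (p + 1) * ∫⁻ _ in Set.Ioo 1 (1 + d), ENNReal.ofReal ((2 * d)⁻¹ ^ (p + 1)) := by
        rw [setLIntegral_const, Real.volume_Ioo, ← ENNReal.ofReal_mul (by positivity),
          ← ENNReal.ofReal_ofNat 2, ← ENNReal.ofReal_pow zero_le_two,
          ← ENNReal.ofReal_mul (by positivity)]
        congr 1
        rw [mul_inv, mul_pow, inv_pow 2, pow_succ d⁻¹]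
        field_simp
        ring
    _ ≤ _ := by
        gcongr _ * ?_
        exact (setLIntegral_mono' measurableSet_Ioo hnear).trans
          (lintegral_mono_set (Set.Ioo_subset_Ioo_right (by linarith : 1 + d ≤ 2)))

variable (μ) in
theorem exists_lintegral_sphere_inv_norm_sub_pow_le {p : ℕ} (hp : p + 1 < Module.finrank ℝ E) :
    ∃ C : ENNReal, C ≠ ⊤ ∧ ∀ z : E,
      ∫⁻ w, ENNReal.ofReal (‖(w : E) - z‖⁻¹ ^ p) ∂μ.toSphere ≤ C := by
  have := Module.nontrivial_of_finrank_pos (Nat.zero_lt_of_lt hp)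
  set W := ∫⁻ x in closedBall 0 1, ENNReal.ofReal (‖x‖⁻¹ ^ (p + 1)) ∂μ
  have hW : W ≠ ⊤ := by
    refine ((hasFiniteIntegral_iff_ofReal (Eventually.of_forall fun x => by positivity)).1
      (integrableOn_closedBall_inv_norm_pow hp 1).2).ne
  refine ⟨μ.toSphere Set.univ + 2 ^ (p + 1) * (W + μ (ball 0 2)), ?_, fun z => ?_⟩
  · have := (measure_ball_lt_top (μ := μ) (x := (0 : E)) (r := 2)).ne
    finiteness
  calc _ ≤ ∫⁻ w, (1 + 2 ^ (p + 1) * ∫⁻ r in Set.Ioo (1 : ℝ) 2,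
        ENNReal.ofReal (r ^ (Module.finrank ℝ E - 1)) *
          ENNReal.ofReal (‖r • (w : E) - z‖⁻¹ ^ (p + 1))) ∂μ.toSphere :=
        lintegral_mono fun w => ofReal_inv_norm_sub_pow_le _ _ (by simp) z
    _ = μ.toSphere Set.univ + 2 ^ (p + 1) * ∫⁻ w, (∫⁻ r in Set.Ioo (1 : ℝ) 2,
        ENNReal.ofReal (r ^ (Module.finrank ℝ E - 1)) *
          ENNReal.ofReal (‖r • (w : E) - z‖⁻¹ ^ (p + 1))) ∂μ.toSphere := by
        rw [lintegral_add_left measurable_const, lintegral_one, lintegral_const_mul' _ _ (by simp)]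
    _ ≤ μ.toSphere Set.univ + 2 ^ (p + 1) *
        ∫⁻ x in ball 0 2, ENNReal.ofReal (‖x - z‖⁻¹ ^ (p + 1)) ∂μ := by
        rw [← lintegral_indicator measurableSet_ball, lintegral_polar
          (Measurable.indicator (by fun_prop) measurableSet_ball)]
        gcongr _ + _ * ?_
        refine lintegral_mono fun w => (setLIntegral_mono' measurableSet_Ioo fun r hr => ?_).trans
          (lintegral_mono_set fun r (hr : r ∈ Set.Ioo (1 : ℝ) 2) => zero_lt_one.trans hr.1)
        have hr0 : |r| < 2 := abs_lt.2 ⟨by linarith [hr.1], hr.2⟩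
        simp [Set.indicator, norm_smul, hr0]
    _ ≤ _ := by
        gcongr
        exact lintegral_inv_norm_sub_pow_le _ _ z

theorem tendsto_lintegral_sphere_rescaled {h : E → E → ENNReal}
    (hm : Measurable (Function.uncurry h)) {C : ENNReal} (hC : C ≠ ⊤)
    (hbound : ∀ z, ∫⁻ w, h (w : E) z ∂μ.toSphere ≤ C)
    (hlim : Tendsto (fun z => ∫⁻ w, h (w : E) z ∂μ.toSphere) (𝓝 0) (𝓝 0))
    {f : E → ℝ} (hfi : Integrable f μ) (x : E) :
    Tendsto (fun r : ℝ => ∫⁻ w, (∫⁻ y, ‖f y‖ₑ * h (w : E) (r⁻¹ • (y - x)) ∂μ) ∂μ.toSphere)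
      atTop (𝓝 0) := by
  have hmr (r : ℝ) : Measurable fun p : sphere (0 : E) 1 × E => h p.1 (r⁻¹ • (p.2 - x)) :=
    hm.comp ((measurable_subtype_coe.comp measurable_fst).prodMk (by fun_prop))
  have hswap (r : ℝ) :
      ∫⁻ w, (∫⁻ y, ‖f y‖ₑ * h (w : E) (r⁻¹ • (y - x)) ∂μ) ∂μ.toSphere
        = ∫⁻ y, ‖f y‖ₑ * ∫⁻ w, h (w : E) (r⁻¹ • (y - x)) ∂μ.toSphere ∂μ := by
    rw [lintegral_lintegral_swap (hfi.1.enorm.comp_snd.mul (hmr r).aemeasurable)]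
    exact lintegral_congr fun y => lintegral_const_mul' _ _ enorm_ne_top
  simp only [hswap]
  rw [← lintegral_zero (μ := μ)]
  refine tendsto_lintegral_filter_of_dominated_convergence' (fun y => ‖f y‖ₑ * C)
    (Eventually.of_forall fun r => hfi.1.enorm.mul (hmr r).lintegral_prod_left'.aemeasurable)
    (Eventually.of_forall fun r => Eventually.of_forall fun y => by gcongr; exact hbound _) ?_
    (Eventually.of_forall fun y => ?_)
  · rw [lintegral_mul_const' _ _ hC]
    exact ENNReal.mul_ne_top hfi.2.ne hC
  · have hz : Tendsto (fun r : ℝ => r⁻¹ • (y - x)) atTop (𝓝 0) := by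
      simpa using (tendsto_inv_atTop_zero (𝕜 := ℝ)).smul_const (y - x)
    simpa using ENNReal.Tendsto.const_mul (hlim.comp hz) (Or.inr enorm_ne_top)

theorem tendsto_lintegral_sphere_kernel {p : ℕ} (hp : p + 1 < Module.finrank ℝ E)
    {h : E → E → ENNReal} (hm : Measurable (Function.uncurry h)) {A : ENNReal} (hA : A ≠ ⊤)
    (hbound : ∀ w z, ‖w‖ = 1 → h w z ≤ A * (1 + ENNReal.ofReal (‖w - z‖⁻¹ ^ p)))
    (hlim : ∀ w, ‖w‖ = 1 → Tendsto (h w) (𝓝 0) (𝓝 0))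
    {f : E → ℝ} (hfi : Integrable f μ) (x : E) :
    Tendsto (fun r : ℝ => ∫⁻ w, (∫⁻ y, ‖f y‖ₑ * h (w : E) (r⁻¹ • (y - x)) ∂μ) ∂μ.toSphere)
      atTop (𝓝 0) := by
  obtain ⟨C, hC, hCb⟩ := exists_lintegral_sphere_inv_norm_sub_pow_le μ hp
  have hmz (z : E) : Measurable fun w : sphere (0 : E) 1 => h w z :=
    hm.comp (measurable_subtype_coe.prodMk measurable_const)
  refine tendsto_lintegral_sphere_rescaled hm (C := A * (μ.toSphere Set.univ + C)) (by finiteness)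
    (fun z => ?_) ?_ hfi x
  · calc _ ≤ ∫⁻ w, A * (1 + ENNReal.ofReal (‖(w : E) - z‖⁻¹ ^ p)) ∂μ.toSphere :=
          lintegral_mono fun w => hbound w z (by simp)
      _ ≤ _ := by
          rw [lintegral_const_mul' _ _ hA, lintegral_add_left measurable_const, lintegral_one]
          gcongr
          exact hCb z
  · rw [← lintegral_zero (μ := μ.toSphere)]
    refine tendsto_lintegral_filter_of_dominated_convergence
      (fun _ => A * (1 + ENNReal.ofReal (2 ^ p))) (Eventually.of_forall hmz) ?_
      (by rw [lintegral_const]; finiteness) (Eventually.of_forall fun w => hlim w (by simp))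
    filter_upwards [closedBall_mem_nhds (0 : E) (by norm_num : (0 : ℝ) < 1 / 2)] with z hz
    refine Eventually.of_forall fun w => (hbound w z (by simp)).trans ?_
    have hwz : 2⁻¹ ≤ ‖(w : E) - z‖ := by
      have := norm_sub_norm_le (w : E) z
      rw [mem_closedBall_zero_iff] at hz
      rw [norm_eq_of_mem_sphere] at this
      linarith
    gcongr
    exact inv_le_of_inv_le₀ two_pos hwz

end Sphere

section Asymptotics

open EuclideanGeometry

theorem tendsto_integral_norm_sq {X ι F : Type*} [MeasurableSpace X] {ν : Measure X}
    [NormedAddCommGroup F] {l : Filter ι} {a : ι → X → F} {b : X → F} (ha : ∀ i, MemLp (a i) 2 ν)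
    (hb : MemLp b 2 ν) (h : Tendsto (fun i => ∫⁻ x, ‖a i x - b x‖ₑ ^ 2 ∂ν) l (𝓝 0)) :
    Tendsto (fun i => ∫ x, ‖a i x‖ ^ 2 ∂ν) l (𝓝 (∫ x, ‖b x‖ ^ 2 ∂ν)) := by
  have hnorm {g : X → F} (hg : MemLp g 2 ν) : ‖hg.toLp‖ ^ 2 = ∫ x, ‖g x‖ ^ 2 ∂ν := by
    rw [Lp.norm_toLp, hg.eLpNorm_eq_integral_rpow_norm two_ne_zero ENNReal.ofNat_ne_top,
      ENNReal.toReal_ofReal (by positivity), ← Real.rpow_natCast, ← Real.rpow_mul (by positivity)]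
    simp
  have hsq (i : ι) : eLpNorm (a i - b) 2 ν = (∫⁻ x, ‖a i x - b x‖ₑ ^ 2 ∂ν) ^ (2⁻¹ : ℝ) := by
    simp [eLpNorm_eq_lintegral_rpow_enorm_toReal]
  have hLp : Tendsto (fun i => (ha i).toLp) l (𝓝 hb.toLp) := by
    rw [Lp.tendsto_Lp_iff_tendsto_eLpNorm'']
    simp only [hsq]
    simpa using h.ennrpow_const 2⁻¹
  simpa only [hnorm] using hLp.norm.pow 2

theorem enorm_integral_smul_sq_le {X F : Type*} [MeasurableSpace X] {ν : Measure X}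
    [NormedAddCommGroup F] [NormedSpace ℝ F] {f : X → ℝ} {k : X → F}
    (hf : AEStronglyMeasurable f ν) (hk : AEStronglyMeasurable k ν) :
    ‖∫ x, f x • k x ∂ν‖ₑ ^ 2 ≤ (∫⁻ x, ‖f x‖ₑ ∂ν) * ∫⁻ x, ‖f x‖ₑ * ‖k x‖ₑ ^ 2 ∂ν := by
  have hroot (t : ENNReal) : (t ^ (2⁻¹ : ℝ)) ^ 2 = t := by
    rw [← ENNReal.rpow_natCast, ← ENNReal.rpow_mul]
    simp
  have hholder := ENNReal.lintegral_mul_le_Lp_mul_Lq ν Real.HolderConjugate.two_two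
    (hf.enorm.pow_const (2⁻¹ : ℝ)) ((hf.enorm.pow_const (2⁻¹ : ℝ)).mul hk.enorm)
  calc ‖∫ x, f x • k x ∂ν‖ₑ ^ 2 ≤ (∫⁻ x, ‖f x • k x‖ₑ ∂ν) ^ 2 := by
        gcongr
        exact enorm_integral_le_lintegral_enorm _
    _ = (∫⁻ x, ‖f x‖ₑ ^ (2⁻¹ : ℝ) * (‖f x‖ₑ ^ (2⁻¹ : ℝ) * ‖k x‖ₑ) ∂ν) ^ 2 := by
        simp only [enorm_smul, ← mul_assoc, ← sq, hroot]
    _ ≤ _ := by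
        refine (pow_le_pow_left₀ zero_le hholder 2).trans_eq ?_
        simp only [one_div, Pi.mul_apply, mul_pow, hroot, ENNReal.rpow_ofNat]

variable {E : Type*} [NormedAddCommGroup E] [InnerProductSpace ℝ E]

theorem contDiff_gradient [CompleteSpace E] {u : E → ℝ} {m k : ℕ∞ω} (hu : ContDiff ℝ k u)
    (hmk : m + 1 ≤ k) : ContDiff ℝ m (∇ u) :=
  (InnerProductSpace.toDual ℝ E).symm.contDiff.comp (hu.fderiv_right hmk)

theorem contDiff_laplacian [FiniteDimensional ℝ E] {u : E → ℝ} {m k : ℕ∞ω} (hu : ContDiff ℝ k u)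
    (hmk : m + 2 ≤ k) : ContDiff ℝ m (Laplacian.laplacian u) := by
  rw [InnerProductSpace.laplacian_eq_iteratedFDeriv_stdOrthonormalBasis]
  exact ContDiff.sum fun i _ => (ContinuousMultilinearMap.apply ℝ (fun _ : Fin 2 => E) ℝ
    ![stdOrthonormalBasis ℝ E i, stdOrthonormalBasis ℝ E i]).contDiff.comp
    (hu.iteratedFDeriv_right hmk)

theorem smul_inversion_smul {r : ℝ} (hr : r ≠ 0) (z : E) :
    r • inversion 0 1 (r • z) = inversion 0 1 z := by
  rw [inversion_zero_one, inversion_zero_one, norm_smul, smul_smul, smul_smul, Real.norm_eq_abs,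
    mul_inv, mul_pow, inv_pow |r|, sq_abs]
  congr 1
  field_simp

theorem add_smul_sub_eq {r : ℝ} (hr : r ≠ 0) (x w y : E) :
    x + r • w - y = r • (w - r⁻¹ • (y - x)) := by
  rw [smul_sub, smul_inv_smul₀ hr]
  abel

theorem inversion_zero_one_of_norm_eq_one {w : E} (hw : ‖w‖ = 1) : inversion 0 1 w = w := by
  simp [inversion_zero_one, hw]

theorem continuousAt_inversion_sub {w : E} (hw : ‖w‖ = 1) :
    ContinuousAt (fun z => inversion 0 1 (w - z)) 0 := by
  have hne : ‖w - 0‖ ≠ 0 := by simp [hw]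
  simp only [inversion_zero_one]
  fun_prop (disch := assumption)

variable [FiniteDimensional ℝ E] [MeasurableSpace E] [BorelSpace E] {μ : Measure E}
  [μ.IsAddHaarMeasure] {f u : E → ℝ} {c : ℝ}

theorem tendsto_lintegral_sphere_inv_norm_sq (hE : 3 < Module.finrank ℝ E) (hfi : Integrable f μ)
    (x : E) :
    Tendsto (fun r : ℝ => ∫⁻ w, (∫⁻ y, ‖f y‖ₑ * ‖‖(w : E) - r⁻¹ • (y - x)‖⁻¹ ^ 2 - 1‖ₑ ∂μ)
      ∂μ.toSphere) atTop (𝓝 0) := by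
  refine tendsto_lintegral_sphere_kernel (h := fun w z => ‖‖w - z‖⁻¹ ^ 2 - 1‖ₑ) hE (by fun_prop)
    ENNReal.one_ne_top (fun w z _ => ?_) (fun w hw => ?_) hfi x
  · rw [one_mul, add_comm, ← ENNReal.ofReal_one, ← ENNReal.ofReal_add (by positivity) zero_le_one,
      Real.enorm_eq_ofReal_abs]
    refine ENNReal.ofReal_le_ofReal ((abs_sub _ _).trans_eq ?_)
    rw [abs_one, abs_of_nonneg (by positivity)]
  · have hne : ‖w - 0‖ ≠ 0 := by simp [hw]
    have hcont : ContinuousAt (fun z => ‖‖w - z‖⁻¹ ^ 2 - 1‖ₑ) 0 := by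
      fun_prop (disch := assumption)
    simpa [hw] using hcont.tendsto

theorem tendsto_lintegral_sphere_inversion_sq (hE : 3 < Module.finrank ℝ E) (hfi : Integrable f μ)
    (x : E) :
    Tendsto (fun r : ℝ => ∫⁻ w,
      (∫⁻ y, ‖f y‖ₑ * ‖inversion 0 1 ((w : E) - r⁻¹ • (y - x)) - w‖ₑ ^ 2 ∂μ) ∂μ.toSphere)
      atTop (𝓝 0) := by
  refine tendsto_lintegral_sphere_kernel (h := fun w z => ‖inversion 0 1 (w - z) - w‖ₑ ^ 2) hE
    ?_ (A := 2) ENNReal.ofNat_ne_top (fun w z hw => ?_) (fun w hw => ?_) hfi x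
  · simp only [inversion_zero_one]
    fun_prop
  · rw [← ofReal_norm, ← ENNReal.ofReal_pow (norm_nonneg _), ← ENNReal.ofReal_one,
      ← ENNReal.ofReal_add zero_le_one (by positivity), ← ENNReal.ofReal_ofNat 2,
      ← ENNReal.ofReal_mul zero_le_two]
    refine ENNReal.ofReal_le_ofReal ?_
    calc ‖inversion 0 1 (w - z) - w‖ ^ 2 ≤ (‖w - z‖⁻¹ + 1) ^ 2 := by
          gcongr
          refine (norm_sub_le _ _).trans_eq ?_
          rw [norm_inversion_zero_one, hw]
      _ ≤ 2 * (1 + ‖w - z‖⁻¹ ^ 2) := by linarith [add_sq_le (a := ‖w - z‖⁻¹) (b := 1)]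
  · have hcont : ContinuousAt (fun z => ‖inversion 0 1 (w - z) - w‖ₑ ^ 2) 0 :=
      (ENNReal.continuous_pow 2).continuousAt.comp
        ((continuousAt_inversion_sub hw).sub continuousAt_const).enorm
    simpa [inversion_zero_one_of_norm_eq_one hw] using hcont.tendsto

namespace IsLogPotential

theorem sq_mul_laplacian_add (hE : 2 < Module.finrank ℝ E) (hf : Continuous f)
    (hfi : Integrable f μ) (hu : IsLogPotential μ c f u) (hu2 : ContDiff ℝ 2 u) (x w : E) {r : ℝ}
    (hr : r ≠ 0) :
    r ^ 2 * Laplacian.laplacian u (x + r • w) + c * (Module.finrank ℝ E - 2) * ∫ y, f y ∂μ =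
      -(c * (Module.finrank ℝ E - 2)) *
        ∫ y, f y * (‖w - r⁻¹ • (y - x)‖⁻¹ ^ 2 - 1) ∂μ := by
  have hint := (isWeaklySingular_inv_norm_pow 2).integrable_sub_mul hE hf hfi (x + r • w)
  have hk (y : E) : f y * (‖w - r⁻¹ • (y - x)‖⁻¹ ^ 2 - 1) =
      r ^ 2 * (‖x + r • w - y‖⁻¹ ^ 2 * f y) - f y := by
    rw [add_smul_sub_eq hr, norm_smul, mul_inv, mul_pow, inv_pow ‖r‖, Real.norm_eq_abs, sq_abs]
    field_simp
  simp only [hk]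
  rw [integral_sub (hint.const_mul _) hfi, integral_const_mul, hu.laplacian_eq hE hf hfi hu2]
  ring

theorem smul_gradient_add (hE : 1 < Module.finrank ℝ E) (hf : Continuous f)
    (hfi : Integrable f μ) (hu : IsLogPotential μ c f u) (hud : Differentiable ℝ u) (x w : E)
    {r : ℝ} (hr : r ≠ 0) :
    r • ∇ u (x + r • w) + (c * ∫ y, f y ∂μ) • w =
      -c • ∫ y, f y • (inversion 0 1 (w - r⁻¹ • (y - x)) - w) ∂μ := by
  have hint := (integrable_smul_inversion hE hf hfi (x + r • w)).fun_smul r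
  have hk (y : E) : f y • (inversion 0 1 (w - r⁻¹ • (y - x)) - w) =
      r • f y • inversion 0 1 (x + r • w - y) - f y • w := by
    rw [add_smul_sub_eq hr, smul_comm r, smul_inversion_smul hr, smul_sub]
  simp only [hk]
  rw [integral_sub hint (hfi.smul_const w), integral_smul, integral_smul_const,
    hu.gradient_eq hE hf hfi (hud _)]
  module

theorem tendsto_integral_sphere_laplacian (hE : 3 < Module.finrank ℝ E) (hf : Continuous f)
    (hfi : Integrable f μ) (hu : IsLogPotential μ c f u) (hu2 : ContDiff ℝ 2 u) (x : E) :
    Tendsto (fun r : ℝ => ∫ w, r ^ 2 * Laplacian.laplacian u (x + r • (w : E)) ∂μ.toSphere) atTop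
      (𝓝 (μ.toSphere.real Set.univ * -(c * (Module.finrank ℝ E - 2) * ∫ y, f y ∂μ))) := by
  have hcont : Continuous (Laplacian.laplacian u) :=
    (contDiff_laplacian (m := 0) hu2 (by simp)).continuous
  have hlim := ENNReal.Tendsto.const_mul (a := ‖c * (Module.finrank ℝ E - 2)‖ₑ)
    (tendsto_lintegral_sphere_inv_norm_sq hE hfi x) (Or.inr enorm_ne_top)
  rw [mul_zero] at hlim
  rw [← smul_eq_mul, ← integral_const]
  refine tendsto_integral_of_L1 _ aestronglyMeasurable_const (Eventually.of_forall fun r =>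
    Continuous.integrable_of_hasCompactSupport (by fun_prop) (.of_compactSpace _)) ?_
  refine tendsto_of_tendsto_of_tendsto_of_le_of_le' tendsto_const_nhds hlim
    (Eventually.of_forall fun _ => zero_le) ?_
  filter_upwards [eventually_gt_atTop 0] with r hr
  rw [← lintegral_const_mul' _ _ enorm_ne_top]
  refine lintegral_mono fun w => ?_
  rw [sub_neg_eq_add, hu.sq_mul_laplacian_add (by omega) hf hfi hu2 x w hr.ne', enorm_mul,
    enorm_neg]
  gcongr
  simpa only [← enorm_mul] using enorm_integral_le_lintegral_enorm _

theorem tendsto_lintegral_sphere_gradient_add (hE : 3 < Module.finrank ℝ E) (hf : Continuous f)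
    (hfi : Integrable f μ) (hu : IsLogPotential μ c f u) (hud : Differentiable ℝ u) (x : E) :
    Tendsto (fun r : ℝ => ∫⁻ w,
      ‖r • ∇ u (x + r • (w : E)) + (c * ∫ y, f y ∂μ) • (w : E)‖ₑ ^ 2 ∂μ.toSphere)
      atTop (𝓝 0) := by
  have hA : ‖c‖ₑ ^ 2 * ∫⁻ y, ‖f y‖ₑ ∂μ ≠ ⊤ := ENNReal.mul_ne_top (by simp) hfi.2.ne
  have hlim := ENNReal.Tendsto.const_mul (tendsto_lintegral_sphere_inversion_sq hE hfi x)
    (Or.inr hA)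
  rw [mul_zero] at hlim
  refine tendsto_of_tendsto_of_tendsto_of_le_of_le' tendsto_const_nhds hlim
    (Eventually.of_forall fun _ => zero_le) ?_
  filter_upwards [eventually_gt_atTop 0] with r hr
  rw [← lintegral_const_mul' _ _ hA]
  refine lintegral_mono fun w => ?_
  rw [hu.smul_gradient_add (by omega) hf hfi hud x w hr.ne', enorm_smul, enorm_neg, mul_pow,
    mul_assoc]
  gcongr
  refine enorm_integral_smul_sq_le hf.aestronglyMeasurable ?_
  simp only [inversion_zero_one]
  exact Measurable.aestronglyMeasurable (by fun_prop)

theorem tendsto_integral_sphere_gradient_sq (hE : 3 < Module.finrank ℝ E) (hf : Continuous f)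
    (hfi : Integrable f μ) (hu : IsLogPotential μ c f u) (hu1 : ContDiff ℝ 1 u) (x : E) :
    Tendsto (fun r : ℝ => ∫ w, r ^ 2 * ‖∇ u (x + r • (w : E))‖ ^ 2 ∂μ.toSphere) atTop
      (𝓝 (μ.toSphere.real Set.univ * (c * ∫ y, f y ∂μ) ^ 2)) := by
  have hcont (r : ℝ) : Continuous fun w : sphere (0 : E) 1 => ∇ u (x + r • (w : E)) :=
    (contDiff_gradient (m := 0) hu1 (by simp)).continuous.comp (by fun_prop)
  have h := tendsto_integral_norm_sq (ν := μ.toSphere) (l := atTop)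
    (a := fun r w => r • ∇ u (x + r • (w : E)))
    (b := fun w => -((c * ∫ y, f y ∂μ) • (w : E)))
    (fun r => ((hcont r).const_smul r).memLp_of_hasCompactSupport (.of_compactSpace _))
    (Continuous.memLp_of_hasCompactSupport (by fun_prop) (.of_compactSpace _))
    (by simpa only [sub_neg_eq_add] using
      hu.tendsto_lintegral_sphere_gradient_add hE hf hfi (hu1.differentiable one_ne_zero) x)
  simpa [norm_smul, mul_pow] using h

end IsLogPotential

end Asymptotics

section Mass

variable {n : ℕ} {u f : RSpace n → ℝ} {c : ℝ}

theorem sphereArea_pred (hn : 0 < n) :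
    sphereArea (n - 1) = (volume : Measure (RSpace n)).toSphere.real Set.univ := by
  obtain ⟨m, rfl⟩ := Nat.exists_eq_succ_of_ne_zero hn.ne'
  rfl

theorem sphereArea_pos (k : ℕ) : 0 < sphereArea k := by
  have hball : 0 < volume.real (ball (0 : RSpace (k + 1)) 1) :=
    ENNReal.toReal_pos (measure_ball_pos _ _ one_pos).ne' measure_ball_lt_top.ne
  rw [sphereArea, Measure.toSphere_real_apply_univ, finrank_euclideanSpace_fin]
  positivity

theorem zpow_mul_sphereIntegral (hn : 0 < n) (g : RSpace n → ℝ) (x : RSpace n) {r : ℝ}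
    (hr : r ≠ 0) :
    r ^ (3 - (n : ℤ)) * sphereIntegral g x r =
      ∫ w, r ^ 2 * g (x + r • (w : RSpace n)) ∂(volume : Measure (RSpace n)).toSphere := by
  have hpow : r ^ (3 - (n : ℤ)) * r ^ (n - 1) = r ^ 2 := by
    rw [← zpow_natCast r (n - 1), ← zpow_add₀ hr, ← zpow_natCast r 2]
    congr 1
    omega
  rw [sphereIntegral, ← mul_assoc, hpow, integral_const_mul]

namespace IsLogPotential

theorem tendsto_sphereIntegral_scalarCurvature (hn : 4 ≤ n) (hf : Continuous f)
    (hfi : Integrable f) (hu : IsLogPotential volume c f u) (hu2 : ContDiff ℝ 2 u) (x : RSpace n) :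
    Tendsto (fun r : ℝ => r ^ (3 - (n : ℤ)) * sphereIntegral
      (fun y => scalarCurvature (conformalMetric u) y * Real.exp (2 * u y)) x r) atTop
      (𝓝 (((n : ℝ) - 1) * (n - 2) * sphereArea (n - 1) *
        ((c * ∫ y, f y) * (2 - c * ∫ y, f y)))) := by
  have hE : 3 < Module.finrank ℝ (RSpace n) := by rw [finrank_euclideanSpace_fin]; omega
  have hu1 : ContDiff ℝ 1 u := hu2.of_le one_le_two
  have hlap (r : ℝ) : Continuous fun w : sphere (0 : RSpace n) 1 =>
      Laplacian.laplacian u (x + r • (w : RSpace n)) :=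
    (contDiff_laplacian (m := 0) hu2 (by simp)).continuous.comp (by fun_prop)
  have hgrad (r : ℝ) : Continuous fun w : sphere (0 : RSpace n) 1 => ∇ u (x + r • (w : RSpace n)) :=
    (contDiff_gradient (m := 0) hu1 (by simp)).continuous.comp (by fun_prop)
  have hlim := ((hu.tendsto_integral_sphere_laplacian hE hf hfi hu2 x).const_mul
    (-(2 * ((n : ℝ) - 1)))).sub ((hu.tendsto_integral_sphere_gradient_sq hE hf hfi hu1 x).const_mul
    (((n : ℝ) - 1) * (n - 2)))
  convert hlim.congr' ?_ using 2
  · rw [finrank_euclideanSpace_fin, ← sphereArea_pred (by omega)]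
    ring
  filter_upwards [eventually_ne_atTop 0] with r hr
  rw [zpow_mul_sphereIntegral (by omega) _ _ hr, ← integral_const_mul, ← integral_const_mul,
    ← integral_sub]
  · simp only [scalarCurvature_conformalMetric_mul_exp hu2]
    congr 1 with w
    ring
  all_goals exact Continuous.integrable_of_hasCompactSupport (by fun_prop) (.of_compactSpace _)

theorem conformalMass_eq (hn : 4 ≤ n) (hf : Continuous f) (hfi : Integrable f)
    (hu : IsLogPotential volume c f u) (hu2 : ContDiff ℝ 2 u) :
    conformalMass u = (((c * ∫ y, f y) * (2 - c * ∫ y, f y) : ℝ) : EReal) := by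
  have hliminf (x : RSpace n) := ((continuous_coe_real_ereal.tendsto _).comp
    (hu.tendsto_sphereIntegral_scalarCurvature hn hf hfi hu2 x)).liminf_eq
  simp only [Function.comp_def] at hliminf
  rw [conformalMass]
  simp only [hliminf, ciInf_const]
  rw [← EReal.coe_mul]
  congr 1
  have hn' : (4 : ℝ) ≤ n := by exact_mod_cast hn
  have h₁ : (n : ℝ) - 1 ≠ 0 := by linarith
  have h₂ : (n : ℝ) - 2 ≠ 0 := by linarith
  have hS := (sphereArea_pos (n - 1)).ne'
  field_simp

end IsLogPotential

end Mass

section RadialDivergence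

variable {E : Type*} [NormedAddCommGroup E] [NormedSpace ℝ E] {f : E → ℝ}

theorem hasDerivAt_pow_mul_comp_smul {k : ℕ} (hk : k ≠ 0) {x : E} {r : ℝ}
    (hf : DifferentiableAt ℝ f (r • x)) :
    HasDerivAt (fun s : ℝ => s ^ k * f (s • x))
      (r ^ (k - 1) * (fderiv ℝ f (r • x) (r • x) + k * f (r • x))) r := by
  have hray : HasDerivAt (fun s : ℝ => s • x) x r := by
    simpa using (hasDerivAt_id r).smul_const x
  refine ((hasDerivAt_pow k r).mul (hf.hasFDerivAt.comp_hasDerivAt r hray)).congr_deriv ?_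
  rw [map_smul, smul_eq_mul, ← mul_pow_sub_one hk r, Function.comp_apply]
  ring

variable [FiniteDimensional ℝ E] [MeasurableSpace E] [BorelSpace E] {μ : Measure E}

theorem integrableOn_ball_of_continuous [IsLocallyFiniteMeasure μ] (hf : Continuous f) (x : E)
    (r : ℝ) : IntegrableOn f (ball x r) μ :=
  (hf.continuousOn.integrableOn_compact (isCompact_closedBall x r)).mono_set ball_subset_closedBall

variable [μ.IsAddHaarMeasure]

theorem setIntegral_ball_fderiv_add [Nontrivial E] (hf : ContDiff ℝ 1 f) {r : ℝ} (hr : 0 ≤ r) :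
    ∫ x in ball 0 r, (fderiv ℝ f x x + Module.finrank ℝ E * f x) ∂μ =
      ∫ w, r ^ Module.finrank ℝ E * f (r • (w : E)) ∂μ.toSphere := by
  have hN : Module.finrank ℝ E ≠ 0 := Module.finrank_pos.ne'
  have hcont : Continuous fun x => fderiv ℝ f x x + Module.finrank ℝ E * f x :=
    ((hf.continuous_fderiv one_ne_zero).clm_apply continuous_id).add (hf.continuous.const_mul _)
  rw [setIntegral_ball_polar (integrableOn_ball_of_continuous hcont 0 r)]
  congr 1 with w
  rw [← integral_Ioc_eq_integral_Ioo, ← intervalIntegral.integral_of_le hr,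
    intervalIntegral.integral_eq_sub_of_hasDerivAt
      (fun s _ => hasDerivAt_pow_mul_comp_smul hN (hf.differentiable one_ne_zero _))
      (Continuous.intervalIntegrable (by fun_prop) 0 r)]
  simp [hN]

/-- `r` times the integral of `|f|` over the sphere `∂B_r(0)`, written as an integral over the unit
sphere. It dominates the flux of the field `f(x) x` through `∂B_r(0)`. -/
noncomputable def sphereFlux (μ : Measure E) (f : E → ℝ) (r : ℝ) : ENNReal :=
  ENNReal.ofReal (r ^ Module.finrank ℝ E) * ∫⁻ w, ‖f (r • (w : E))‖ₑ ∂μ.toSphere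

omit [FiniteDimensional ℝ E] [BorelSpace E] [μ.IsAddHaarMeasure] in
theorem enorm_integral_pow_mul_le_sphereFlux (f : E → ℝ) {r : ℝ} (hr : 0 ≤ r) :
    ‖∫ w, r ^ Module.finrank ℝ E * f (r • (w : E)) ∂μ.toSphere‖ₑ ≤ sphereFlux μ f r := by
  refine (enorm_integral_le_lintegral_enorm _).trans_eq ?_
  simp only [enorm_mul, Real.enorm_eq_ofReal (pow_nonneg hr _)]
  rw [lintegral_const_mul' _ _ ENNReal.ofReal_ne_top, sphereFlux]

theorem measurable_sphereFlux (hf : Measurable f) : Measurable (sphereFlux μ f) := by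
  have hm : Measurable fun p : ℝ × sphere (0 : E) 1 => ‖f (p.1 • (p.2 : E))‖ₑ := by fun_prop
  exact Measurable.mul (by fun_prop) hm.lintegral_prod_right'

theorem lintegral_inv_mul_sphereFlux [Nontrivial E] (hf : Measurable f) :
    ∫⁻ r in Set.Ioi (0 : ℝ), ENNReal.ofReal r⁻¹ * sphereFlux μ f r = ∫⁻ x, ‖f x‖ₑ ∂μ := by
  rw [lintegral_polar hf.enorm, lintegral_lintegral_swap (by fun_prop)]
  refine setLIntegral_congr_fun measurableSet_Ioi fun r (hr : 0 < r) => ?_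
  rw [lintegral_const_mul' _ _ ENNReal.ofReal_ne_top, sphereFlux, ← mul_assoc,
    ← ENNReal.ofReal_mul (by positivity), ← mul_pow_sub_one Module.finrank_pos.ne' r,
    inv_mul_cancel_left₀ hr.ne']

end RadialDivergence

theorem lintegral_Ioi_inv_eq_top {a : ℝ} (ha : 0 ≤ a) :
    ∫⁻ r in Set.Ioi a, ENNReal.ofReal r⁻¹ = ⊤ := by
  by_contra hfin
  refine not_integrableOn_Ioi_inv (a := a) ⟨by fun_prop, ?_⟩
  rw [hasFiniteIntegral_iff_ofReal]
  · exact Ne.lt_top hfin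
  · filter_upwards [ae_restrict_mem measurableSet_Ioi] with r hr
    exact inv_nonneg.2 (ha.trans hr.out.le)

theorem exists_lt_of_lintegral_inv_mul_ne_top {H : ℝ → ENNReal}
    (hH : ∫⁻ r in Set.Ioi (0 : ℝ), ENNReal.ofReal r⁻¹ * H r ≠ ⊤) {ε : ENNReal} (hε : ε ≠ 0)
    (R : ℝ) : ∃ r, R < r ∧ H r < ε := by
  by_contra! hcon
  refine hH (top_le_iff.1 ?_)
  calc ⊤ = ∫⁻ r in Set.Ioi (max R 0), ENNReal.ofReal r⁻¹ * ε := by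
        rw [lintegral_mul_const _ (by fun_prop), lintegral_Ioi_inv_eq_top (le_max_right _ _),
          ENNReal.top_mul hε]
    _ ≤ ∫⁻ r in Set.Ioi (max R 0), ENNReal.ofReal r⁻¹ * H r :=
        setLIntegral_mono' measurableSet_Ioi fun r hr => by
          gcongr
          exact hcon r ((le_max_left _ _).trans_lt hr)
    _ ≤ _ := lintegral_mono_set (Set.Ioi_subset_Ioi (le_max_right _ _))

theorem exists_seq_tendsto_of_lintegral_inv_mul_ne_top {H : ℝ → ENNReal}
    (hH : ∫⁻ r in Set.Ioi (0 : ℝ), ENNReal.ofReal r⁻¹ * H r ≠ ⊤) :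
    ∃ R : ℕ → ℝ, (∀ k, 0 < R k) ∧ Tendsto R atTop atTop ∧ Tendsto (H ∘ R) atTop (𝓝 0) := by
  choose R hR hHR using fun k : ℕ =>
    exists_lt_of_lintegral_inv_mul_ne_top hH (ENNReal.inv_ne_zero.2 (ENNReal.natCast_ne_top k)) k
  refine ⟨R, fun k => (Nat.cast_nonneg k).trans_lt (hR k),
    tendsto_atTop_mono (fun k => (hR k).le) tendsto_natCast_atTop_atTop, ?_⟩
  exact tendsto_of_tendsto_of_tendsto_of_le_of_le tendsto_const_nhds
    ENNReal.tendsto_inv_nat_nhds_zero (fun _ => zero_le) fun k => (hHR k).le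

section Interaction

open EuclideanGeometry

variable {E : Type*} [NormedAddCommGroup E] [InnerProductSpace ℝ E] {f : E → ℝ}

/-- The density `f(x) f(y) x · (x - y) / |x - y|²` on pairs `(x, y)`; the inversion in the unit
sphere sends `z` to `z / |z|²`, and its junk value at `0` only affects the diagonal. -/
noncomputable def pairDensity (f : E → ℝ) (p : E × E) : ℝ :=
  f p.1 * (inner ℝ (inversion 0 1 (p.1 - p.2)) p.1 * f p.2)

theorem pairDensity_add_swap (f : E → ℝ) {x y : E} (hxy : x ≠ y) :
    pairDensity f (x, y) + pairDensity f (y, x) = f x * f y := by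
  have hone : inner ℝ (inversion 0 1 (x - y)) (x - y) = (1 : ℝ) := by
    have := norm_ne_zero_iff.2 (sub_ne_zero.2 hxy)
    rw [inversion_zero_one, real_inner_smul_left, real_inner_self_eq_norm_sq]
    field_simp
  have hodd : inversion 0 1 (y - x) = -inversion 0 1 (x - y) := by
    rw [inversion_zero_one, inversion_zero_one, ← neg_sub x y, norm_neg, smul_neg]
  rw [inner_sub_right] at hone
  simp only [pairDensity, hodd, inner_neg_left]
  linear_combination (f x * f y) * hone

theorem abs_pairDensity_le (f : E → ℝ) (p : E × E) :
    |pairDensity f p| ≤ |f p.1| * |f p.2| * (‖p.1‖ * ‖p.1 - p.2‖⁻¹) := by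
  have hinner := abs_real_inner_le_norm (inversion 0 1 (p.1 - p.2)) p.1
  rw [norm_inversion_zero_one] at hinner
  calc |pairDensity f p|
      = |f p.1| * |f p.2| * |inner ℝ (inversion 0 1 (p.1 - p.2)) p.1| := by
        rw [pairDensity, abs_mul, abs_mul]; ring
    _ ≤ _ := by rw [mul_comm ‖p.1‖]; gcongr

omit [InnerProductSpace ℝ E] in
theorem ofReal_norm_div_mul_lintegral_inv_le (a b : E) :
    ENNReal.ofReal (‖a‖ * ‖a - b‖⁻¹) * ∫⁻ r in Set.Ioc ‖a‖ ‖b‖, ENNReal.ofReal r⁻¹ ≤ 1 := by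
  rcases eq_or_ne a 0 with rfl | ha
  · simp
  have ha' : 0 < ‖a‖ := norm_pos_iff.2 ha
  calc _ ≤ ENNReal.ofReal (‖a‖ * ‖a - b‖⁻¹) * ∫⁻ _ in Set.Ioc ‖a‖ ‖b‖, ENNReal.ofReal ‖a‖⁻¹ := by
        gcongr _ * ?_
        exact setLIntegral_mono' measurableSet_Ioc fun r hr =>
          ENNReal.ofReal_le_ofReal (inv_anti₀ ha' hr.1.le)
    _ = ENNReal.ofReal (‖a - b‖⁻¹ * (‖b‖ - ‖a‖)) := by
        rw [setLIntegral_const, Real.volume_Ioc, ← ENNReal.ofReal_mul (by positivity),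
          ← ENNReal.ofReal_mul (by positivity)]
        congr 1
        field_simp
    _ ≤ ENNReal.ofReal (‖a - b‖⁻¹ * ‖a - b‖) := by
        gcongr
        exact norm_sub_rev b a ▸ norm_sub_norm_le b a
    _ ≤ 1 := ENNReal.ofReal_le_one.2 inv_mul_le_one

theorem enorm_pairDensity_mul_lintegral_inv_le (f : E → ℝ) (p : E × E) :
    ‖pairDensity f p‖ₑ * ∫⁻ r in Set.Ioc ‖p.1‖ ‖p.2‖, ENNReal.ofReal r⁻¹ ≤
      ‖f p.1‖ₑ * ‖f p.2‖ₑ := by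
  calc _ ≤ ENNReal.ofReal (|f p.1| * |f p.2| * (‖p.1‖ * ‖p.1 - p.2‖⁻¹)) *
        ∫⁻ r in Set.Ioc ‖p.1‖ ‖p.2‖, ENNReal.ofReal r⁻¹ := by
        rw [Real.enorm_eq_ofReal_abs]
        gcongr
        exact abs_pairDensity_le f p
    _ ≤ _ := by
        rw [ENNReal.ofReal_mul (by positivity), ENNReal.ofReal_mul (abs_nonneg _), mul_assoc,
          ← Real.enorm_eq_ofReal_abs, ← Real.enorm_eq_ofReal_abs]
        exact mul_le_of_le_one_right' (ofReal_norm_div_mul_lintegral_inv_le p.1 p.2)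

variable [FiniteDimensional ℝ E] [MeasurableSpace E] [BorelSpace E] {μ : Measure E}

theorem measurable_pairDensity (hf : Measurable f) : Measurable (pairDensity f) := by
  unfold pairDensity
  simp only [inversion_zero_one]
  fun_prop

/-- The interaction, in absolute value, of `B_r(0)` with its complement. -/
noncomputable def crossInteraction (μ : Measure E) (f : E → ℝ) (r : ℝ) : ENNReal :=
  ∫⁻ p, ‖pairDensity f p‖ₑ ∂((μ.restrict (ball 0 r)).prod (μ.restrict (ball 0 r)ᶜ))

theorem lintegral_inv_mul_crossInteraction [SFinite μ] (hf : Measurable f) :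
    ∫⁻ r in Set.Ioi (0 : ℝ), ENNReal.ofReal r⁻¹ * crossInteraction μ f r =
      ∫⁻ p : E × E, ‖pairDensity f p‖ₑ *
        (∫⁻ r in Set.Ioc ‖p.1‖ ‖p.2‖, ENNReal.ofReal r⁻¹) ∂(μ.prod μ) := by
  have hm := measurable_pairDensity hf
  set F : ℝ → E × E → ENNReal := fun r p =>
    (Set.Ioc ‖p.1‖ ‖p.2‖).indicator (fun r => ENNReal.ofReal r⁻¹ * ‖pairDensity f p‖ₑ) r with hF
  have hFm : Measurable (Function.uncurry F) :=
    Measurable.indicator (f := fun q : ℝ × (E × E) => ENNReal.ofReal q.1⁻¹ * ‖pairDensity f q.2‖ₑ)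
      (by fun_prop) ((measurableSet_lt (by fun_prop) measurable_fst).inter
        (measurableSet_le measurable_fst (by fun_prop)))
  calc _ = ∫⁻ r in Set.Ioi (0 : ℝ), ∫⁻ p, F r p ∂(μ.prod μ) := by
        congr 1 with r
        rw [crossInteraction, Measure.prod_restrict,
          ← lintegral_const_mul' _ _ ENNReal.ofReal_ne_top,
          ← lintegral_indicator (measurableSet_ball.prod measurableSet_ball.compl)]
        simp [hF, Set.indicator]
    _ = ∫⁻ p, (∫⁻ r in Set.Ioi (0 : ℝ), F r p) ∂(μ.prod μ) :=
        lintegral_lintegral_swap hFm.aemeasurable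
    _ = _ := by
        congr 1 with p
        have hsub : Set.Ioc ‖p.1‖ ‖p.2‖ ⊆ Set.Ioi 0 := fun r hr => (norm_nonneg _).trans_lt hr.1
        rw [lintegral_indicator measurableSet_Ioc, Measure.restrict_restrict_of_subset hsub,
          lintegral_mul_const' _ _ enorm_ne_top, mul_comm]

theorem lintegral_inv_mul_crossInteraction_le [SFinite μ] (hf : Measurable f) :
    ∫⁻ r in Set.Ioi (0 : ℝ), ENNReal.ofReal r⁻¹ * crossInteraction μ f r ≤
      (∫⁻ x, ‖f x‖ₑ ∂μ) ^ 2 := by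
  rw [lintegral_inv_mul_crossInteraction hf, sq,
    ← lintegral_prod_mul hf.enorm.aemeasurable hf.enorm.aemeasurable]
  exact lintegral_mono (enorm_pairDensity_mul_lintegral_inv_le f)

variable [μ.IsAddHaarMeasure]

theorem integrable_pairDensity (hE : 1 < Module.finrank ℝ E) (hf : Continuous f)
    (hfi : Integrable f μ) (r : ℝ) :
    Integrable (pairDensity f) ((μ.restrict (ball 0 r)).prod μ) := by
  have hm := (measurable_pairDensity hf.measurable).aestronglyMeasurable
    (μ := (μ.restrict (ball 0 r)).prod μ)
  have hpot : Continuous fun x => |f x| * ‖x‖ * ∫ y, ‖x - y‖⁻¹ ^ 1 * |f y| ∂μ :=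
    (hf.abs.mul continuous_norm).mul
      ((isWeaklySingular_inv_norm_pow 1).continuous_integral_sub_mul hE hf.abs hfi.abs)
  refine (integrable_prod_iff hm).2 ⟨Eventually.of_forall fun x =>
    ((isWeaklySingular_inner_inversion x).integrable_sub_mul hE hf hfi x).const_mul (f x), ?_⟩
  refine (integrableOn_ball_of_continuous hpot 0 r).mono' hm.norm.integral_prod_right'
    (Eventually.of_forall fun x => ?_)
  rw [Real.norm_of_nonneg (by positivity), ← integral_const_mul]
  refine integral_mono_of_nonneg (Eventually.of_forall fun y => norm_nonneg _)
    (((isWeaklySingular_inv_norm_pow 1).integrable_sub_mul hE hf.abs hfi.abs x).const_mul _)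
    (Eventually.of_forall fun y => (abs_pairDensity_le f (x, y)).trans_eq ?_)
  ring

theorem two_mul_integral_pairDensity_ball (hE : 1 < Module.finrank ℝ E) (hf : Continuous f)
    (hfi : Integrable f μ) (r : ℝ) :
    2 * ∫ p, pairDensity f p ∂((μ.restrict (ball 0 r)).prod (μ.restrict (ball 0 r))) =
      (∫ x in ball 0 r, f x ∂μ) ^ 2 := by
  have := Module.nontrivial_of_finrank_pos (Nat.zero_lt_of_lt hE)
  set ν := μ.restrict (ball 0 r)
  have hi : Integrable (pairDensity f) (ν.prod ν) :=
    (integrable_pairDensity hE hf hfi r).mono_measure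
      (Measure.prod_mono le_rfl Measure.restrict_le_self)
  have hi' : Integrable (fun p : E × E => pairDensity f p.swap) (ν.prod ν) := hi.swap
  calc _ = ∫ p : E × E, (pairDensity f p + pairDensity f p.swap) ∂(ν.prod ν) := by
        rw [integral_add hi hi', integral_prod_swap, two_mul]
    _ = ∫ x, ∫ y, f x * f y ∂ν ∂ν := by
        rw [integral_prod _ (hi.fun_add hi')]
        refine integral_congr_ae (Eventually.of_forall fun x => integral_congr_ae ?_)
        filter_upwards [ae_restrict_of_ae (Measure.ae_ne μ x)] with y hy
        exact pairDensity_add_swap f hy.symm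
    _ = _ := by simp only [integral_const_mul, integral_mul_const, sq]

theorem enorm_integral_pairDensity_sub_le (hE : 1 < Module.finrank ℝ E) (hf : Continuous f)
    (hfi : Integrable f μ) (r : ℝ) :
    ‖(∫ x in ball 0 r, f x * ∫ y, inner ℝ (inversion 0 1 (x - y)) x * f y ∂μ ∂μ)
      - (∫ x in ball 0 r, f x ∂μ) ^ 2 / 2‖ₑ ≤ crossInteraction μ f r := by
  have hi := integrable_pairDensity hE hf hfi r
  have hmono (s : Set E) :
      Integrable (pairDensity f) ((μ.restrict (ball 0 r)).prod (μ.restrict s)) :=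
    hi.mono_measure (Measure.prod_mono le_rfl Measure.restrict_le_self)
  have hsplit : ∫ x in ball 0 r, f x * ∫ y, inner ℝ (inversion 0 1 (x - y)) x * f y ∂μ ∂μ =
      (∫ p, pairDensity f p ∂((μ.restrict (ball 0 r)).prod (μ.restrict (ball 0 r)))) +
        ∫ p, pairDensity f p ∂((μ.restrict (ball 0 r)).prod (μ.restrict (ball 0 r)ᶜ)) := by
    rw [← integral_add_measure (hmono _) (hmono _), ← Measure.prod_add,
      Measure.restrict_add_restrict_compl measurableSet_ball, integral_prod _ hi]
    simp only [pairDensity, integral_const_mul]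
  rw [hsplit, ← two_mul_integral_pairDensity_ball hE hf hfi r, mul_div_cancel_left₀ _ two_ne_zero,
    add_sub_cancel_left]
  exact enorm_integral_le_lintegral_enorm _

end Interaction

section Pohozaev

open EuclideanGeometry

variable {E : Type*} [NormedAddCommGroup E] [InnerProductSpace ℝ E]

theorem inner_gradient_mul_exp [CompleteSpace E] {Q u : E → ℝ} {x : E}
    (hQ : DifferentiableAt ℝ Q x) (hu : DifferentiableAt ℝ u x) (κ : ℝ) :
    inner ℝ x (∇ Q x) * Real.exp (κ * u x) =
      fderiv ℝ (fun y => Q y * Real.exp (κ * u y)) x x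
        - κ * (Q x * Real.exp (κ * u x) * fderiv ℝ u x x) := by
  have h : HasFDerivAt (fun y => Q y * Real.exp (κ * u y)) _ x :=
    hQ.hasFDerivAt.mul (hu.hasFDerivAt.const_mul κ).exp
  rw [real_inner_comm, inner_gradient_left, h.fderiv]
  simp only [add_apply, smul_apply, smul_eq_mul]
  ring

variable [FiniteDimensional ℝ E] [MeasurableSpace E] [BorelSpace E] {μ : Measure E}
  [μ.IsAddHaarMeasure] {f u : E → ℝ} {c : ℝ}

theorem IsLogPotential.setIntegral_ball_fderiv_sub (hE : 1 < Module.finrank ℝ E)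
    (hf : ContDiff ℝ 1 f) (hfi : Integrable f μ) (hu : IsLogPotential μ c f u)
    (hu1 : ContDiff ℝ 1 u) (κ : ℝ) {r : ℝ} (hr : 0 ≤ r) :
    ∫ x in ball 0 r, (fderiv ℝ f x x - κ * (f x * fderiv ℝ u x x)) ∂μ =
      (∫ w, r ^ Module.finrank ℝ E * f (r • (w : E)) ∂μ.toSphere)
        - Module.finrank ℝ E * ∫ x in ball 0 r, f x ∂μ
        + κ * c * ∫ x in ball 0 r, f x * ∫ y, inner ℝ (inversion 0 1 (x - y)) x * f y ∂μ ∂μ := by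
  have := Module.nontrivial_of_finrank_pos (Nat.zero_lt_of_lt hE)
  have hf0 := hf.continuous
  have hf' : Continuous fun x => fderiv ℝ f x x :=
    (hf.continuous_fderiv one_ne_zero).clm_apply continuous_id
  have hu' : Continuous fun x => fderiv ℝ u x x :=
    (hu1.continuous_fderiv one_ne_zero).clm_apply continuous_id
  have hint {g : E → ℝ} (hg : Continuous g) : IntegrableOn g (ball 0 r) μ :=
    integrableOn_ball_of_continuous hg 0 r
  have hpot (x : E) : f x * fderiv ℝ u x x =
      -c * (f x * ∫ y, inner ℝ (inversion 0 1 (x - y)) x * f y ∂μ) := by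
    rw [hu.fderiv_apply hE hf0 hfi (hu1.differentiable one_ne_zero x)]; ring
  rw [← setIntegral_ball_fderiv_add hf hr, integral_sub (hint hf') (hint (by fun_prop)),
    integral_add (hint hf') (hint (by fun_prop)), integral_const_mul, integral_const_mul]
  simp only [hpot, integral_const_mul]
  ring

omit [InnerProductSpace ℝ E] [FiniteDimensional ℝ E] [μ.IsAddHaarMeasure] in
theorem tendsto_setIntegral_ball (hfi : Integrable f μ) :
    Tendsto (fun r : ℝ => ∫ x in ball 0 r, f x ∂μ) atTop (𝓝 (∫ x, f x ∂μ)) :=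
  (aecover_ball tendsto_id).integral_tendsto_of_countably_generated hfi

theorem exists_seq_tendsto_flux_and_pair (hE : 1 < Module.finrank ℝ E) (hf : Continuous f)
    (hfi : Integrable f μ) :
    ∃ R : ℕ → ℝ, (∀ k, 0 < R k) ∧ Tendsto R atTop atTop ∧
      Tendsto (fun k => ∫ w, R k ^ Module.finrank ℝ E * f (R k • (w : E)) ∂μ.toSphere)
        atTop (𝓝 0) ∧
      Tendsto (fun k => ∫ x in ball 0 (R k),
          f x * ∫ y, inner ℝ (inversion 0 1 (x - y)) x * f y ∂μ ∂μ)
        atTop (𝓝 ((∫ x, f x ∂μ) ^ 2 / 2)) := by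
  have := Module.nontrivial_of_finrank_pos (Nat.zero_lt_of_lt hE)
  have hfin : ∫⁻ r in Set.Ioi (0 : ℝ), ENNReal.ofReal r⁻¹ *
      (sphereFlux μ f r + crossInteraction μ f r) ≠ ⊤ := by
    have hflux := measurable_sphereFlux (μ := μ) hf.measurable
    simp only [mul_add]
    rw [lintegral_add_left (by fun_prop), lintegral_inv_mul_sphereFlux hf.measurable]
    exact ENNReal.add_ne_top.2 ⟨hfi.2.ne, ne_top_of_le_ne_top (ENNReal.pow_ne_top hfi.2.ne)
      (lintegral_inv_mul_crossInteraction_le hf.measurable)⟩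
  obtain ⟨R, hRpos, hR, hsmall⟩ := exists_seq_tendsto_of_lintegral_inv_mul_ne_top hfin
  have hzero {a : ℕ → ℝ} (ha : ∀ k, ‖a k‖ₑ ≤ sphereFlux μ f (R k) + crossInteraction μ f (R k)) :
      Tendsto a atTop (𝓝 0) :=
    tendsto_zero_iff_enorm_tendsto_zero.2 <| tendsto_of_tendsto_of_tendsto_of_le_of_le
      tendsto_const_nhds hsmall (fun _ => zero_le) ha
  refine ⟨R, hRpos, hR, hzero fun k =>
    le_add_right (enorm_integral_pow_mul_le_sphereFlux f (hRpos k).le), ?_⟩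
  have hpair := hzero fun k => le_add_left (enorm_integral_pairDensity_sub_le hE hf hfi (R k))
  simpa using hpair.add ((((tendsto_setIntegral_ball hfi).comp hR).pow 2).div_const 2)

theorem IsLogPotential.exists_seq_tendsto_setIntegral_ball (hE : 1 < Module.finrank ℝ E)
    (hf : ContDiff ℝ 1 f) (hfi : Integrable f μ) (hu : IsLogPotential μ c f u)
    (hu1 : ContDiff ℝ 1 u) (κ : ℝ) :
    ∃ R : ℕ → ℝ, Tendsto R atTop atTop ∧
      Tendsto (fun k => ∫ x in ball 0 (R k), (fderiv ℝ f x x - κ * (f x * fderiv ℝ u x x)) ∂μ)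
        atTop (𝓝 (κ * c * ((∫ x, f x ∂μ) ^ 2 / 2) - Module.finrank ℝ E * ∫ x, f x ∂μ)) := by
  obtain ⟨R, hRpos, hR, hflux, hpair⟩ := exists_seq_tendsto_flux_and_pair hE hf.continuous hfi
  refine ⟨R, hR, ?_⟩
  simp only [hu.setIntegral_ball_fderiv_sub hE hf hfi hu1 κ (hRpos _).le]
  have hball := ((tendsto_setIntegral_ball hfi).comp hR).const_mul (Module.finrank ℝ E : ℝ)
  have hsum := (hflux.sub hball).add (hpair.const_mul (κ * c))
  rwa [zero_sub, neg_add_eq_sub] at hsum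

end Pohozaev

section Main

variable {n : ℕ} {u : RSpace n → ℝ}

theorem contDiff_iterate_neg_laplacian (hu : ContDiff ℝ ∞ u) (k : ℕ) :
    ContDiff ℝ ∞ ((fun f : RSpace n → ℝ => -Laplacian.laplacian f)^[k] u) := by
  induction k with
  | zero => exact hu
  | succ k ih =>
    rw [Function.iterate_succ_apply']
    exact (contDiff_laplacian (m := ∞) ih le_rfl).neg

theorem contDiff_qCurvature (hu : ContDiff ℝ ∞ u) : ContDiff ℝ ∞ (qCurvature u) :=
  (contDiff_iterate_neg_laplacian hu (n / 2)).mul (contDiff_const.mul hu).neg.exp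

theorem mainTheorem12_general (hn : 4 ≤ n) {c : ℝ} {Q : RSpace n → ℝ} (hQ : ContDiff ℝ 1 Q)
    (hu : ContDiff ℝ 2 u) (hQi : Integrable fun x => Q x * Real.exp (n * u x))
    (hpot : IsLogPotential volume c (fun x => Q x * Real.exp (n * u x)) u) :
    (Integrable (fun x => inner ℝ x (∇ Q x) * Real.exp (n * u x)) →
      conformalMass u =
        ((-(2 * c / n) * ∫ x, inner ℝ x (∇ Q x) * Real.exp (n * u x) : ℝ) : EReal)) ∧
    (∀ I : ℝ, Tendsto (fun r : ℝ => ∫ x in ball 0 r, inner ℝ x (∇ Q x) * Real.exp (n * u x))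
        atTop (𝓝 I) →
      conformalMass u = ((-(2 * c / n) * I : ℝ) : EReal)) ∧
    (∃ m : ℝ, conformalMass u = (m : EReal) ∧
      ∃ R : ℕ → ℝ, Tendsto R atTop atTop ∧
        Tendsto (fun k : ℕ => -(2 * c / n) *
          ∫ x in ball 0 (R k), inner ℝ x (∇ Q x) * Real.exp (n * u x)) atTop (𝓝 m)) := by
  have hu1 : ContDiff ℝ 1 u := hu.of_le one_le_two
  have hf : ContDiff ℝ 1 fun x => Q x * Real.exp (n * u x) := hQ.mul (contDiff_const.mul hu1).exp
  have hmass := hpot.conformalMass_eq hn hf.continuous hQi hu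
  obtain ⟨R, hR, hlim⟩ :=
    hpot.exists_seq_tendsto_setIntegral_ball (by rw [finrank_euclideanSpace_fin]; omega)
      hf hQi hu1 n
  simp only [← inner_gradient_mul_exp (hQ.differentiable one_ne_zero _)
    (hu1.differentiable one_ne_zero _)] at hlim
  replace hlim := hlim.const_mul (-(2 * c / n))
  have hconst (A : ℝ) : -(2 * c / n) * (n * c * (A ^ 2 / 2) - n * A) = c * A * (2 - c * A) := by
    have : (n : ℝ) ≠ 0 := by positivity
    field_simp
    ring
  rw [finrank_euclideanSpace_fin, hconst] at hlim
  have himproper (I : ℝ) (hI : Tendsto (fun r : ℝ =>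
      ∫ x in ball 0 r, inner ℝ x (∇ Q x) * Real.exp (n * u x)) atTop (𝓝 I)) :
      conformalMass u = ((-(2 * c / n) * I : ℝ) : EReal) := by
    rw [hmass, tendsto_nhds_unique hlim ((hI.comp hR).const_mul _)]
  exact ⟨fun hint => himproper _ (tendsto_setIntegral_ball hint), himproper, _, hmass, R, hR, hlim⟩

end Main

theorem mainTheorem12 (n : ℕ) (hn : 4 ≤ n) (hne : Even n) (u : RSpace n → ℝ)
    (hu : ContDiff ℝ ∞ u) (hQ : HasFiniteTotalQCurvature u) (hnormal : IsNormalMetric u) :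
    -- the identity, when the integral converges absolutely
    (Integrable (pohozaevDensity u) →
      conformalMass u
        = ((-(4 / (n ! * sphereArea n)) * ∫ x : RSpace n, pohozaevDensity u x : ℝ) : EReal)) ∧
    -- the identity, when the integral converges as an improper integral over balls
    (∀ I : ℝ, Tendsto (fun r : ℝ => ∫ x in ball (0 : RSpace n) r, pohozaevDensity u x) atTop (𝓝 I) →
      conformalMass u = ((-(4 / (n ! * sphereArea n)) * I : ℝ) : EReal)) ∧
    -- in all cases, along a sequence of balls
    (∃ m : ℝ, conformalMass u = (m : EReal) ∧
      ∃ R : ℕ → ℝ, Tendsto R atTop atTop ∧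
        Tendsto (fun k : ℕ => -(4 / (n ! * sphereArea n)) *
          ∫ x in ball (0 : RSpace n) (R k), pohozaevDensity u x) atTop (𝓝 m)) := by
  have hconst : 4 / (n ! * sphereArea n) = 2 * (2 / ((n - 1)! * sphereArea n)) / n := by
    rw [← Nat.mul_factorial_pred (by omega : n ≠ 0), Nat.cast_mul]; ring
  rw [hconst]
  exact mainTheorem12_general hn (contDiff_infty.1 (contDiff_qCurvature hu) 1)
    (contDiff_infty.1 hu 2) hQ hnormal.2
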